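/- Let $m,n\ge 1$ and $T$ be integers and write $i^*=\min[m,n]$. For a prime power $q\ge 2$, let $\mathrm{Ch}_{\mathsf m}$ be the memoryless channel with input $X\in\mathbb F_q^{m\times T}$ and output $Y=GX\in\mathbb F_q^{n\times T}$, where the transfer matrix $G$ is uniformly distributed over $\mathbb F_q^{n\times m}$, independent of $X$, and unknown to transmitter and receiver. Its capacity is $C_{\mathsf m}=\max_{P_X} I(X;Y)$, in bits. Let $\binom{T}{d}_q$ be the Gaussian coefficient, i.e. the number of $d$-dimensional subspaces of $\mathbb F_q^T$, and let $\psi(n,d)$ be the number of $n\times T$ matrices over $\mathbb F_q$ whose rows span a given $d$-dimensional subspace of $\mathbb F_q^T$ (this number depends only on $n$, $d$ and $q$). Put $$\epsilon_q(l)=\sum_{d=0}^{\min[n,l]}\psi(n,d)\binom{l}{d}_q q^{-nl}\log_2\left(\binom{T}{d}_q\Big/\binom{i^*}{d}_q\right)-\min[n,l]\,(T-i^*)\log_2 q .$$ **Theorem.** Suppose $T>n+\min[m,n]$. 1. There are prime powers $q$ that satisfy all the inequalities $$\frac{\epsilon_q(l)-\epsilon_q(i^*)}{(T-n-i^*)(i^*-l)}\le\log_2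 q\quad(0\le l\le i^*-1),\qquad \frac{\epsilon_q(l)-\epsilon_q(i^*)}{i^*(l-i^*)}\le\log_2 q\quad(i^*+1\le l\le m).\tag{$*$}$$ Let $q_0$ be the smallest of them. Then for every prime power $q\ge q_0$ the maximum defining the capacity is attained, and $$C_{\mathsf m}=\sum_{l=0}^{i^*}\psi(n,l)\binom{i^*}{l}_q q^{-ni^*}\log_2\left(\binom{T}{l}_q\Big/\binom{i^*}{l}_q\right).$$ 2. For every $q\ge q_0$ the capacity is achieved by sending, with equal probabilities, matrices whose rows span the different $i^*$-dimensional subspaces of $\mathbb F_q^T$, one matrix for each subspace; more generally, it is achieved by every input distribution for which the row space of $X$ is uniformly distributed over the $i^*$-dimensional subspaces of $\mathbb F_q^T$. 3. As $q\to\infty$ through the prime powers, with $m,n,T$ fixed, $$C_{\mathsf m}=i^*(T-i^*)\log_2 q-\mathbf 1_{\{n\le m\}}(T-i^*)\frac{\log_2 q}{q}+(\log_2 e)\,q^{-1}+o(q^{-1}).$$ Moreover, for fixed $m,n$ there is a $T_0$ such that for all $T\ge T_0$ the inequalities $(*)$ hold (so that $q\ge q_0$) for every prime power $q$ with $q^{\,n-m+1}\ge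 5m^2$ if $m\le n$, and for every prime power $q$ with $q\ge nT$ if $m>n$. -/

import Mathlib

open Filter Module

universe u

noncomputable section

namespace NonCoherent

variable (F : Type u) [Field F] [Fintype F]

/-- The span of the rows of a matrix. -/
def rowSpace {F : Type u} [Field F] {k T : ℕ} (M : Matrix (Fin k) (Fin T) F) :
    Submodule F (Fin T → F) :=
  Submodule.span F (Set.range M.row)

/-- The Grassmannian: all `d`-dimensional subspaces of `F ^ T`. -/
def grassmannian (F : Type u) [Field F] (T d : ℕ) : Set (Submodule F (Fin T → F)) :=
  {π | finrank F π = d}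

/-- The Gaussian coefficient: the number of `d`-dimensional subspaces of `F ^ T`. -/
def gaussNum (F : Type u) [Field F] (T d : ℕ) : ℕ := Nat.card (grassmannian F T d)

/-- The number of `n × T` matrices whose rows span the given subspace `π` of `F ^ T`. -/
def psi {F : Type u} [Field F] (n : ℕ) {T : ℕ} (π : Submodule F (Fin T → F)) : ℕ :=
  Nat.card {M : Matrix (Fin n) (Fin T) F // rowSpace M = π}

/-- The shorthand `ψ(n, d)`: the value of `psi n π` at the `d`-dimensional subspace `π = F ^ d` of
`F ^ d`. By `psi_eq_psiNum` this is the value at every `d`-dimensional subspace of every `F ^ T`. -/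
def psiNum (F : Type u) [Field F] (n d : ℕ) : ℕ := psi n (⊤ : Submodule F (Fin d → F))

theorem psi_eq_psiNum {F : Type u} [Field F] (n : ℕ) {T : ℕ} (π : Submodule F (Fin T → F)) :
    psi n π = psiNum F n (finrank F π) := by
  classical
  let e : π ≃ₗ[F] (Fin (finrank F π) → F) := (finBasis F π).equivFun
  let φ : (Fin (finrank F π) → F) →ₗ[F] (Fin T → F) := π.subtype ∘ₗ e.symm.toLinearMap
  have hφ : Function.Injective φ := π.injective_subtype.comp e.symm.injective
  have hr : Submodule.map φ ⊤ = π := by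
    rw [Submodule.map_top, LinearMap.range_comp, LinearEquiv.range, Submodule.map_top,
      Submodule.range_subtype]
  have key : ∀ M : Matrix (Fin n) (Fin (finrank F π)) F,
      rowSpace (Matrix.of fun i => φ (M i)) = Submodule.map φ (rowSpace M) := by
    intro M
    unfold rowSpace
    rw [Submodule.map_span, ← Set.range_comp]
    rfl
  symm
  refine Nat.card_congr (Equiv.ofBijective
    (fun M => ⟨Matrix.of fun i => φ (M.1 i), by rw [key, M.2, hr]⟩) ⟨?_, ?_⟩)
  · intro M N h
    apply Subtype.ext
    funext i
    exact hφ (congrFun (Subtype.ext_iff.mp h) i)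
  · rintro ⟨N, hN⟩
    have hmem : ∀ i, N i ∈ π := fun i => hN ▸ Submodule.subset_span ⟨i, rfl⟩
    have hN' : (Matrix.of fun i => φ ((Matrix.of fun j => e ⟨N j, hmem j⟩) i)) = N := by
      funext i
      change ((e.symm (e ⟨N i, hmem i⟩) : π) : Fin T → F) = N i
      rw [LinearEquiv.symm_apply_apply]
    refine ⟨⟨Matrix.of fun j => e ⟨N j, hmem j⟩, ?_⟩, Subtype.ext hN'⟩
    apply Submodule.map_injective_of_injective hφ
    rw [← key, hN', hN, hr]

/-- The transition probability `P(Y | X)` of the non-coherent matrix channel `Y = G X`, where the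
transfer matrix `G` is uniformly distributed over all `n × m` matrices. -/
def transition {F : Type u} [Field F] {m n T : ℕ} (X : Matrix (Fin m) (Fin T) F)
    (Y : Matrix (Fin n) (Fin T) F) : ℝ :=
  (Nat.card {G : Matrix (Fin n) (Fin m) F // G * X = Y} : ℝ) /
    (Nat.card (Matrix (Fin n) (Fin m) F) : ℝ)

/-- The set of input distributions: probability vectors on the `m × T` matrices. -/
abbrev inputDistributions (m T : ℕ) : Set (Matrix (Fin m) (Fin T) F → ℝ) :=
  stdSimplex ℝ (Matrix (Fin m) (Fin T) F)

/-- The output distribution induced by the input distribution `P`. -/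
def outputDistribution {F : Type u} [Field F] [Fintype F] {m n T : ℕ}
    (P : Matrix (Fin m) (Fin T) F → ℝ) (Y : Matrix (Fin n) (Fin T) F) : ℝ :=
  ∑ X, P X * transition X Y

/-- The mutual information `I(X; Y)` in bits, for the input distribution `P` and `n` output rows. -/
def mutualInformation {F : Type u} [Field F] [Fintype F] {m T : ℕ} (n : ℕ)
    (P : Matrix (Fin m) (Fin T) F → ℝ) : ℝ :=
  ∑ X, ∑ Y : Matrix (Fin n) (Fin T) F,
    P X * transition X Y * Real.logb 2 (transition X Y / outputDistribution P Y)

/-- The capacity: the maximum of the mutual information over the input distributions. -/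
def capacity (m n T : ℕ) : ℝ :=
  sSup (mutualInformation n '' inputDistributions F m T)

/-- The input distribution `P` achieves the capacity. -/
def IsCapacityAchieving {F : Type u} [Field F] [Fintype F] {m T : ℕ} (n : ℕ)
    (P : Matrix (Fin m) (Fin T) F → ℝ) : Prop :=
  P ∈ inputDistributions F m T ∧ mutualInformation n P = capacity F m n T

/-- The uniform distribution on a set of matrices. -/
def uniformOn {F : Type u} {m T : ℕ} (C : Set (Matrix (Fin m) (Fin T) F)) :
    Matrix (Fin m) (Fin T) F → ℝ :=
  C.indicator fun _ => (C.ncard : ℝ)⁻¹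

open Classical in
/-- The probability that the rows of the input matrix span `π`. -/
def rowSpaceLaw {F : Type u} [Field F] [Fintype F] {m T : ℕ}
    (P : Matrix (Fin m) (Fin T) F → ℝ) (π : Submodule F (Fin T → F)) : ℝ :=
  ∑ X with rowSpace X = π, P X

/-- `∑_{d = 0}^{min(n, l)} ψ(n, d) [l, d] q^{-n l} log₂ ([T, d] / [i, d])` with `i = min(m, n)`. -/
def rateSum (m n T l : ℕ) : ℝ :=
  ∑ d ∈ Finset.range (min n l + 1),
    (psiNum F n d : ℝ) * (gaussNum F l d : ℝ) * ((Fintype.card F : ℝ) ^ (n * l))⁻¹ *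
      Real.logb 2 ((gaussNum F T d : ℝ) / (gaussNum F (min m n) d : ℝ))

/-- The error term `ε_q(l)`. -/
def errorTerm (m n T l : ℕ) : ℝ :=
  rateSum F m n T l -
    (min n l : ℕ) * ((T : ℝ) - (min m n : ℕ)) * Real.logb 2 (Fintype.card F)

/-- The set of inequalities that the size of `F` has to satisfy. -/
def SatisfiesInequalities (m n T : ℕ) : Prop :=
  (∀ l : ℕ, l < min m n →
    (errorTerm F m n T l - errorTerm F m n T (min m n)) /
      (((T : ℝ) - n - (min m n : ℕ)) * ((min m n : ℕ) - (l : ℝ))) ≤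
        Real.logb 2 (Fintype.card F)) ∧
  (∀ l : ℕ, min m n + 1 ≤ l → l ≤ m →
    (errorTerm F m n T l - errorTerm F m n T (min m n)) /
      (((min m n : ℕ) : ℝ) * ((l : ℝ) - (min m n : ℕ))) ≤
        Real.logb 2 (Fintype.card F))

/-- The sizes of the finite fields that satisfy the set of inequalities. -/
def admissibleSizes (m n T : ℕ) : Set ℕ :=
  {q | ∃ (F : Type) (_ : Field F) (_ : Fintype F),
    Fintype.card F = q ∧ SatisfiesInequalities F m n T}

end NonCoherent

end

/-!
An output `Y` of the channel with input `X` is uniform over the matrices whose rows lie in the row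
space of `X`, so the divergence of the output law from the output law `Q` of the proposed input
(`grassmannianOutput`) depends only on the rank `l` of `X`: it is `rateSum l - n (l - i) log₂ q`,
where `i = min m n` (`sum_transition_mul_logb`). The inequalities on the field size say precisely
that this is largest at `l = i` (`satisfiesInequalities_iff_rateSum`). They are thus the
Karush-Kuhn-Tucker conditions, and Gibbs' inequality gives the capacity (`capacity_eq_rateSum`).

Sorting matrices by row space turns `rateSum l` into a mean over the rank of a uniformly random
`n × l` matrix (`sum_psiNum_mul_gaussNum`). The rank is a Markov chain in the number of columns: a
new column stays in an `r`-dimensional column space with probability `q ^ r / q ^ n`. Hence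
`rateSum l` is `log₂ q` times a sum over `j < l` of terms `rankGain j`, the mean of
`(1 - q ^ (r - n)) log_q ((q ^ T - q ^ r) / (q ^ i - q ^ r))` over the rank `r` after `j` columns.
The conditions read `∑ j ∈ [l, i), rankGain j ≥ n (i - l)` for `l < i`, and
`∑ j ∈ [i, l), rankGain j ≤ n (l - i)` for `l > i`, in which case `i = n`.

What has to be shown is that they persist when the field grows, and it suffices to pass from `q` to
`q + 1`, prime power or not. For `j < i`, if `(q + 1) ^ (n - i + 1) ≥ n + 1` then every term is at
least `n` (`le_rankGain_of_le_pow`); otherwise `T - i > n` is large compared with `q`, and each term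
increases (`rankGain_le_succ`). For `j ≥ n = i` each term decreases (`rankGain_succ_le`). Both facts
rest on sharp two-sided bounds for the probability that a column does not raise the rank. With
`Q = q ^ (n - r)`, the number of vectors orthogonal to the columns, this probability is the mean of
`1 / Q`; the factorial moments of `Q` are explicit, and interpolating `Q ↦ 1 / Q` at powers of `q`
bounds it by polynomials in `Q` (`le_stallProb`, `stallProb_pred_le`, `one_sub_stallProb_le`,
`le_one_sub_stallProb`).

The same bounds show that the conditions hold for all `q ≥ n T`, and, if `m ≤ n`, for every `q` once
`T ≥ 2 n + m`; they also give the expansion of the capacity, in which only the term `j = i - 1`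
contributes at order `1 / q` (`abs_sum_rankGain_sub_le`).
-/

namespace NonCoherent

/-! ### Counting subspaces over a finite field -/

section Counting

variable {F : Type u} [Field F]

theorem card_submodule_finrank (V : Type*) [AddCommGroup V] [Module F V] [FiniteDimensional F V]
    (d : ℕ) :
    Nat.card {W : Submodule F V // finrank F W = d} = gaussNum F (finrank F V) d := by
  let e : V ≃ₗ[F] (Fin (finrank F V) → F) := (finBasis F V).equivFun
  have h : ∀ W : Submodule F V, finrank F W = d ↔
      finrank F ((Submodule.orderIsoMapComap e).toEquiv W) = d := fun W => by
    rw [← LinearEquiv.finrank_map_eq e W]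
    rfl
  exact Nat.card_congr ((Submodule.orderIsoMapComap e).toEquiv.subtypeEquiv h)

theorem card_linearIndependent_span_eq [Fintype F] {V : Type*} [AddCommGroup V] [Module F V]
    [FiniteDimensional F V] {d : ℕ} (W : Submodule F V) (hW : finrank F W = d) :
    Nat.card {s : Fin d → V // LinearIndependent F s ∧ Submodule.span F (Set.range s) = W} =
      ∏ i : Fin d, (Fintype.card F ^ d - Fintype.card F ^ (i : ℕ)) := by
  rw [← hW] at *
  have : Finite V := Module.finite_of_finite F
  have h := card_linearIndependent (K := F) (V := W) (k := finrank F W) le_rfl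
  rw [← h]
  refine Nat.card_congr (Equiv.symm ?_)
  refine Equiv.ofBijective (fun t => ⟨fun i => (t.1 i : V), ?_, ?_⟩) ⟨?_, ?_⟩
  · exact t.2.map' W.subtype W.ker_subtype
  · have hli : LinearIndependent F (fun i => (t.1 i : V)) := t.2.map' W.subtype W.ker_subtype
    refine Submodule.eq_of_le_of_finrank_eq (Submodule.span_le.2 ?_) ?_
    · rintro _ ⟨i, rfl⟩
      exact (t.1 i).2
    · rw [finrank_span_eq_card hli, Fintype.card_fin]
  · intro a b hab
    apply Subtype.ext
    funext i
    exact Subtype.ext (congrFun (Subtype.ext_iff.1 hab) i)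
  · rintro ⟨s, hs, hsp⟩
    have hmem : ∀ i, s i ∈ W := fun i => hsp ▸ Submodule.subset_span ⟨i, rfl⟩
    exact ⟨⟨fun i => ⟨s i, hmem i⟩, LinearIndependent.of_comp W.subtype hs⟩, rfl⟩

/-- The Gaussian coefficient counts linearly independent `d`-tuples up to change of basis. -/
theorem gaussNum_mul_prod [Fintype F] {T d : ℕ} (hd : d ≤ T) :
    gaussNum F T d * ∏ i : Fin d, (Fintype.card F ^ d - Fintype.card F ^ (i : ℕ)) =
      ∏ i : Fin d, (Fintype.card F ^ T - Fintype.card F ^ (i : ℕ)) := by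
  classical
  have hV : finrank F (Fin T → F) = T := by simp
  have h := card_linearIndependent (K := F) (V := Fin T → F) (k := d) (by rw [hV]; exact hd)
  rw [hV] at h
  rw [← h]
  let sp : {s : Fin d → (Fin T → F) // LinearIndependent F s} → grassmannian F T d :=
    fun s => ⟨Submodule.span F (Set.range s.1), by
      change finrank F _ = d
      rw [finrank_span_eq_card s.2, Fintype.card_fin]⟩
  rw [← Nat.card_congr (Equiv.sigmaFiberEquiv sp), Nat.card_sigma]
  have hfib : ∀ W : grassmannian F T d, Nat.card {s // sp s = W} =
      ∏ i : Fin d, (Fintype.card F ^ d - Fintype.card F ^ (i : ℕ)) := by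
    intro W
    rw [← card_linearIndependent_span_eq W.1 W.2]
    refine Nat.card_congr ((Equiv.subtypeEquivRight fun s => ?_).trans
      (Equiv.subtypeSubtypeEquivSubtypeInter (fun s => LinearIndependent F s)
        (fun s => Submodule.span F (Set.range s) = W.1)))
    exact Subtype.ext_iff
  rw [Finset.sum_congr rfl fun W _ => hfib W, Finset.sum_const, Finset.card_univ, smul_eq_mul,
    ← Nat.card_eq_fintype_card (α := grassmannian F T d), gaussNum]

theorem card_le_submodule_finrank {T d : ℕ} (W : Submodule F (Fin T → F)) :
    Nat.card {U : Submodule F (Fin T → F) // U ≤ W ∧ finrank F U = d} =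
      gaussNum F (finrank F W) d := by
  rw [← card_submodule_finrank W d]
  symm
  refine Nat.card_congr ?_
  refine ((Submodule.mapIic W).toEquiv.subtypeEquiv (q := fun U : Set.Iic W => finrank F U.1 = d) ?_).trans
    (Equiv.subtypeSubtypeEquivSubtypeInter (fun U => U ∈ Set.Iic W) (fun U => finrank F U = d))
  intro U
  change finrank F U = d ↔ finrank F (U.map W.subtype) = d
  rw [← (Submodule.equivMapOfInjective W.subtype W.injective_subtype U).finrank_eq]

/-- The number of `i`-dimensional subspaces containing a given subspace. -/
theorem card_ge_submodule_finrank {T i : ℕ} (W : Submodule F (Fin T → F)) (hW : finrank F W ≤ i) :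
    Nat.card {U : Submodule F (Fin T → F) // W ≤ U ∧ finrank F U = i} =
      gaussNum F (T - finrank F W) (i - finrank F W) := by
  have hq : finrank F ((Fin T → F) ⧸ W) = T - finrank F W := by
    have := W.finrank_quotient_add_finrank
    rw [Module.finrank_fintype_fun_eq_card, Fintype.card_fin] at this
    omega
  rw [← hq, ← card_submodule_finrank]
  symm
  refine Nat.card_congr ?_
  refine ((Submodule.comapMkQRelIso W).toEquiv.subtypeEquiv
    (q := fun U : Set.Ici W => finrank F U.1 = i) ?_).trans
    (Equiv.subtypeSubtypeEquivSubtypeInter (fun U => U ∈ Set.Ici W) (fun U => finrank F U = i))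
  intro U
  change finrank F U = _ ↔ finrank F (U.comap W.mkQ) = i
  have h := LinearMap.finrank_range_add_finrank_ker (W.mkQ.domRestrict (U.comap W.mkQ))
  rw [LinearMap.range_domRestrict, Submodule.map_comap_eq_of_surjective W.mkQ_surjective,
    LinearMap.ker_domRestrict, Submodule.ker_mkQ,
    (Submodule.comapSubtypeEquivOfLe (Submodule.le_comap_mkQ W U)).finrank_eq] at h
  omega

end Counting

section Counting

variable {F : Type u} [Field F]

theorem gaussNum_pos [Finite F] {T d : ℕ} (hd : d ≤ T) : 0 < gaussNum F T d := by
  have := Fintype.ofFinite F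
  refine Nat.pos_of_ne_zero fun h => ?_
  have h1 := gaussNum_mul_prod (F := F) hd
  rw [h, zero_mul, eq_comm, Finset.prod_eq_zero_iff] at h1
  obtain ⟨i, -, hi⟩ := h1
  have : Fintype.card F ^ (i : ℕ) < Fintype.card F ^ T :=
    Nat.pow_lt_pow_right Fintype.one_lt_card (by omega)
  omega

/-- Double counting of the flags `W ≤ U` with `dim W = d` and `dim U = i`. -/
theorem card_flags [Finite F] {T i d : ℕ} (hdi : d ≤ i) :
    gaussNum F T d * gaussNum F (T - d) (i - d) = gaussNum F T i * gaussNum F i d := by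
  classical
  have h1 : Nat.card (Σ W : {W : Submodule F (Fin T → F) // finrank F W = d},
      {U : Submodule F (Fin T → F) // W.1 ≤ U ∧ finrank F U = i}) =
      gaussNum F T d * gaussNum F (T - d) (i - d) := by
    have := Fintype.ofFinite {W : Submodule F (Fin T → F) // finrank F W = d}
    rw [Nat.card_sigma, Finset.sum_congr rfl fun W _ => by
      rw [card_ge_submodule_finrank W.1 (by rw [W.2]; exact hdi), W.2], Finset.sum_const,
      Finset.card_univ, smul_eq_mul, ← Nat.card_eq_fintype_card]
    rfl
  have h2 : Nat.card (Σ U : {U : Submodule F (Fin T → F) // finrank F U = i},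
      {W : Submodule F (Fin T → F) // W ≤ U.1 ∧ finrank F W = d}) =
      gaussNum F T i * gaussNum F i d := by
    have := Fintype.ofFinite {W : Submodule F (Fin T → F) // finrank F W = i}
    rw [Nat.card_sigma, Finset.sum_congr rfl fun W _ => by
      rw [card_le_submodule_finrank W.1, W.2], Finset.sum_const,
      Finset.card_univ, smul_eq_mul, ← Nat.card_eq_fintype_card]
    rfl
  rw [← h1, ← h2]
  exact Nat.card_congr
    ⟨fun x => ⟨⟨x.2.1, x.2.2.2⟩, ⟨x.1.1, x.2.2.1, x.1.2⟩⟩,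
      fun x => ⟨⟨x.2.1, x.2.2.2⟩, ⟨x.1.1, x.2.2.1, x.1.2⟩⟩, fun _ => rfl, fun _ => rfl⟩

theorem gaussNum_eq_prod_div [Fintype F] {T d : ℕ} (hd : d ≤ T) :
    (gaussNum F T d : ℝ) =
      (∏ i ∈ Finset.range d, ((Fintype.card F : ℝ) ^ T - (Fintype.card F : ℝ) ^ i)) /
        ∏ i ∈ Finset.range d, ((Fintype.card F : ℝ) ^ d - (Fintype.card F : ℝ) ^ i) := by
  have hq : (1 : ℝ) < Fintype.card F := by exact_mod_cast Fintype.one_lt_card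
  have key : ∀ a, d ≤ a →
      ((∏ i : Fin d, (Fintype.card F ^ a - Fintype.card F ^ (i : ℕ)) : ℕ) : ℝ) =
      ∏ i ∈ Finset.range d, ((Fintype.card F : ℝ) ^ a - (Fintype.card F : ℝ) ^ i) := by
    intro a ha
    rw [Nat.cast_prod, ← Fin.prod_univ_eq_prod_range
      fun i => ((Fintype.card F : ℝ) ^ a - (Fintype.card F : ℝ) ^ i)]
    refine Finset.prod_congr rfl fun i _ => ?_
    rw [Nat.cast_sub (Nat.pow_le_pow_right Fintype.card_pos (i.2.le.trans ha))]
    push_cast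
    rfl
  rw [← key T hd, ← key d le_rfl, ← gaussNum_mul_prod hd, Nat.cast_mul, mul_div_cancel_right₀]
  rw [key d le_rfl]
  refine Finset.prod_ne_zero_iff.2 fun i hi => ?_
  exact (sub_pos.2 (pow_lt_pow_right₀ hq (Finset.mem_range.1 hi))).ne'

theorem logb_gaussNum_div [Fintype F] {T i d : ℕ} (hd : d ≤ i) (hi : i ≤ T) :
    Real.logb 2 ((gaussNum F T d : ℝ) / (gaussNum F i d : ℝ)) =
      ∑ r ∈ Finset.range d, Real.logb 2 (((Fintype.card F : ℝ) ^ T - (Fintype.card F : ℝ) ^ r) /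
        ((Fintype.card F : ℝ) ^ i - (Fintype.card F : ℝ) ^ r)) := by
  have hq : (1 : ℝ) < Fintype.card F := by exact_mod_cast Fintype.one_lt_card
  have h : ∀ a, d ≤ a → ∀ r ∈ Finset.range d,
      0 < (Fintype.card F : ℝ) ^ a - (Fintype.card F : ℝ) ^ r := fun a ha r hr =>
    sub_pos.2 (pow_lt_pow_right₀ hq ((Finset.mem_range.1 hr).trans_le ha))
  rw [gaussNum_eq_prod_div (hd.trans hi), gaussNum_eq_prod_div hd,
    div_div_div_cancel_right₀ (Finset.prod_ne_zero_iff.2 fun r hr => (h d le_rfl r hr).ne'),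
    ← Finset.prod_div_distrib, Real.logb_prod]
  exact fun r hr => (div_pos (h T (hd.trans hi) r hr) (h i hd r hr)).ne'

end Counting

/-! ### The rank of a uniformly random matrix -/

/-- The mean of `f (rank M)` for a uniformly random `n × j` matrix `M` over the field with `q`
elements, defined by adding one column at a time: a new column lies in a given `r`-dimensional
subspace of `F ^ n` with probability `q ^ r / q ^ n`. -/
noncomputable def rankMean (q : ℝ) (n : ℕ) : ℕ → (ℕ → ℝ) → ℝ
  | 0, f => f 0
  | j + 1, f => rankMean q n j fun r => q ^ r / q ^ n * f r + (1 - q ^ r / q ^ n) * f (r + 1)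

/-- The dimension of the span of `l` uniformly random vectors is distributed as the rank in
`rankMean`. -/
theorem sum_finrank_span_range {F : Type u} [Field F] [Fintype F] {V : Type*} [AddCommGroup V]
    [Module F V] [Fintype V] (l : ℕ) (f : ℕ → ℝ) :
    ∑ M : Fin l → V, f (finrank F (Submodule.span F (Set.range M))) =
      ((Fintype.card F : ℝ) ^ finrank F V) ^ l *
        rankMean (Fintype.card F) (finrank F V) l f := by
  classical
  induction l generalizing f with
  | zero =>
    rw [Fintype.sum_unique, Set.range_eq_empty, Submodule.span_empty, finrank_bot]
    simp [rankMean]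
  | succ l ih =>
    rw [rankMean, pow_succ, mul_assoc, ← mul_comm (rankMean _ _ _ _), ← mul_assoc, ← ih,
      ← (Fin.consEquiv fun _ : Fin (l + 1) => V).sum_comp, Fintype.sum_prod_type,
      Finset.sum_comm, Finset.sum_mul]
    refine Finset.sum_congr rfl fun M _ => ?_
    change ∑ v : V, f (finrank F (Submodule.span F (Set.range (Fin.cons v M : Fin (l + 1) → V)))) = _
    set W := Submodule.span F (Set.range M) with hW
    have h : ∀ v : V, f (finrank F (Submodule.span F (Set.range (Fin.cons v M : Fin (l+1) → V)))) =
        if v ∈ W then f (finrank F W) else f (finrank F W + 1) := by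
      intro v
      rw [Fin.range_cons, Submodule.span_insert, ← hW, sup_comm]
      split_ifs with hv
      · rw [sup_eq_left.2 ((Submodule.span_singleton_le_iff_mem v W).2 hv)]
      · rw [Submodule.finrank_sup_span_singleton hv]
    rw [Finset.sum_congr rfl fun v _ => h v, Finset.sum_ite, Finset.sum_const, Finset.sum_const,
      nsmul_eq_mul, nsmul_eq_mul]
    have hc : (({v | v ∈ W} : Finset V).card : ℝ) = (Fintype.card F : ℝ) ^ finrank F W := by
      have := Module.card_eq_pow_finrank (K := F) (V := W)
      rw [← Fintype.card_subtype]
      exact_mod_cast this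
    have hc' : (({v | v ∉ W} : Finset V).card : ℝ) =
        (Fintype.card F : ℝ) ^ finrank F V - (Fintype.card F : ℝ) ^ finrank F W := by
      rw [← hc, eq_sub_iff_add_eq', ← Nat.cast_add, Finset.card_filter_add_card_filter_not,
        Finset.card_univ, Module.card_eq_pow_finrank (K := F)]
      push_cast
      rfl
    rw [hc, hc']
    field_simp

theorem finrank_rowSpace {F : Type u} [Field F] {k T : ℕ} (M : Matrix (Fin k) (Fin T) F) :
    finrank F (rowSpace M) = M.rank := by
  rw [Matrix.rank_eq_finrank_span_row, rowSpace]

/-- The `n × T` matrices with row space inside `π`, sorted by their row space. -/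
theorem sum_rowSpace_le {F : Type u} [Field F] [Fintype F] (n : ℕ) {T : ℕ}
    (π : Submodule F (Fin T → F)) [DecidablePred fun Y : Matrix (Fin n) (Fin T) F =>
      rowSpace Y ≤ π] (f : ℕ → ℝ) :
    ∑ Y : Matrix (Fin n) (Fin T) F with rowSpace Y ≤ π, f Y.rank =
      ∑ d ∈ Finset.range (min n (finrank F π) + 1),
        (psiNum F n d : ℝ) * (gaussNum F (finrank F π) d : ℝ) * f d := by
  classical
  have hmaps : ∀ M ∈ (Finset.univ.filter fun Y : Matrix (Fin n) (Fin T) F => rowSpace Y ≤ π),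
      M.rank ∈ Finset.range (min n (finrank F π) + 1) := fun M hM => by
    have h1 := M.rank_le_height
    have h2 := Submodule.finrank_mono (Finset.mem_filter.1 hM).2
    rw [finrank_rowSpace] at h2
    rw [Finset.mem_range]
    omega
  rw [← Finset.sum_fiberwise_of_maps_to hmaps]
  refine Finset.sum_congr rfl fun d _ => ?_
  rw [Finset.sum_congr rfl fun M hM => by rw [(Finset.mem_filter.1 hM).2], Finset.sum_const,
    nsmul_eq_mul, Finset.filter_filter]
  congr 1
  rw [← Nat.cast_mul, Nat.cast_inj, ← Fintype.card_subtype, ← Nat.card_eq_fintype_card]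
  let g : {M : Matrix (Fin n) (Fin T) F // rowSpace M ≤ π ∧ M.rank = d} →
      {U : Submodule F (Fin T → F) // U ≤ π ∧ finrank F U = d} :=
    fun M => ⟨rowSpace M.1, M.2.1, (finrank_rowSpace M.1).trans M.2.2⟩
  have hfib : ∀ W, Nat.card {M // g M = W} = psiNum F n d := by
    intro W
    have hW : finrank F W.1 = d := W.2.2
    rw [show psiNum F n d = psi n W.1 by rw [psi_eq_psiNum, hW], psi]
    refine Nat.card_congr ⟨fun M => ⟨M.1.1, Subtype.ext_iff.1 M.2⟩,
      fun M => ⟨⟨M.1, by rw [M.2]; exact W.2.1, by rw [← finrank_rowSpace, M.2, hW]⟩,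
        Subtype.ext M.2⟩, fun _ => rfl, fun _ => rfl⟩
  have := Fintype.ofFinite {U : Submodule F (Fin T → F) // U ≤ π ∧ finrank F U = d}
  rw [← Nat.card_congr (Equiv.sigmaFiberEquiv g), Nat.card_sigma,
    Finset.sum_congr rfl fun W _ => hfib W, Finset.sum_const, Finset.card_univ, smul_eq_mul,
    ← Nat.card_eq_fintype_card, card_le_submodule_finrank, mul_comm]

/-- The rank distribution of a uniformly random `n × l` matrix, in terms of `psiNum` and Gaussian
coefficients. -/
theorem sum_psiNum_mul_gaussNum {F : Type u} [Field F] [Fintype F] (n l : ℕ) (f : ℕ → ℝ) :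
    ∑ d ∈ Finset.range (min n l + 1),
      (psiNum F n d : ℝ) * (gaussNum F l d : ℝ) * ((Fintype.card F : ℝ) ^ (n * l))⁻¹ * f d =
      rankMean (Fintype.card F) n l f := by
  classical
  have hq : (Fintype.card F : ℝ) ≠ 0 := by exact_mod_cast Fintype.card_ne_zero
  have h1 := sum_finrank_span_range (F := F) (V := Fin n → F) l f
  rw [finrank_fintype_fun_eq_card, Fintype.card_fin, ← pow_mul] at h1
  have h2 : ∑ M : Fin l → (Fin n → F), f (finrank F (Submodule.span F (Set.range M))) =
      ∑ M : Matrix (Fin n) (Fin l) F, f M.rank := by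
    refine Fintype.sum_equiv (Matrix.transposeAddEquiv (Fin l) (Fin n) F).toEquiv _ _ fun M => ?_
    change _ = f (Matrix.transpose M).rank
    rw [Matrix.rank_transpose, ← finrank_rowSpace]
    rfl
  have h3 := sum_rowSpace_le n (⊤ : Submodule F (Fin l → F)) f
  rw [Finset.filter_true_of_mem fun _ _ => le_top, finrank_top, finrank_fintype_fun_eq_card,
    Fintype.card_fin] at h3
  rw [h2, h3] at h1
  rw [← inv_mul_cancel_left₀ (pow_ne_zero (n * l) hq) (rankMean _ _ _ _), ← h1, Finset.mul_sum]
  exact Finset.sum_congr rfl fun d _ => by ring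

/-! ### The gain of one more column -/

/-- Only the ranks `r ≤ min n j` matter: the weight of the transition from `n` to `n + 1` is zero.
-/
theorem rankMean_mono {q : ℝ} (hq : 1 ≤ q) {n j : ℕ} {f g : ℕ → ℝ}
    (h : ∀ r, r ≤ n → r ≤ j → f r ≤ g r) : rankMean q n j f ≤ rankMean q n j g := by
  induction j generalizing f g with
  | zero => exact h 0 (Nat.zero_le _) le_rfl
  | succ j ih =>
    refine ih fun r hr hj => ?_
    have h0 : 0 ≤ q ^ r / q ^ n := by positivity
    refine add_le_add (mul_le_mul_of_nonneg_left (h r hr (by omega)) h0) ?_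
    rcases hr.eq_or_lt with rfl | hr
    · rw [div_self (by positivity)]
      simp
    · have h1 : q ^ r / q ^ n ≤ 1 :=
        (div_le_one (by positivity)).2 (pow_le_pow_right₀ hq hr.le)
      exact mul_le_mul_of_nonneg_left (h (r + 1) hr (by omega)) (by linarith)

theorem rankMean_add (q : ℝ) (n j : ℕ) (f g : ℕ → ℝ) :
    rankMean q n j (fun r => f r + g r) = rankMean q n j f + rankMean q n j g := by
  induction j generalizing f g with
  | zero => rfl
  | succ j ih =>
    simp only [rankMean]
    rw [← ih]
    congr 1
    funext r
    ring

theorem rankMean_const_mul (q : ℝ) (n j : ℕ) (c : ℝ) (f : ℕ → ℝ) :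
    rankMean q n j (fun r => c * f r) = c * rankMean q n j f := by
  induction j generalizing f with
  | zero => rfl
  | succ j ih =>
    simp only [rankMean]
    rw [← ih]
    congr 1
    funext r
    ring

theorem rankMean_const (q : ℝ) (n j : ℕ) (c : ℝ) : rankMean q n j (fun _ => c) = c := by
  induction j with
  | zero => rfl
  | succ j ih =>
    simp only [rankMean]
    rw [← ih]
    congr 1
    funext r
    rw [ih]
    ring

/-- The mean of the logarithm (in base `b`) gained when a uniformly random `n × j` matrix gets one
more random column, if a matrix of rank `d` is worth the logarithm of
`∏ r < d, (q ^ T - q ^ r) / (q ^ i - q ^ r)`. -/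
noncomputable def rankGain (b q : ℝ) (n T i j : ℕ) : ℝ :=
  rankMean q n j fun r => (1 - q ^ r / q ^ n) * Real.logb b ((q ^ T - q ^ r) / (q ^ i - q ^ r))

theorem rankMean_sum_logb_succ (b q : ℝ) (n T i j : ℕ) :
    rankMean q n (j + 1) (fun d => ∑ r ∈ Finset.range d,
      Real.logb b ((q ^ T - q ^ r) / (q ^ i - q ^ r))) =
    rankMean q n j (fun d => ∑ r ∈ Finset.range d,
      Real.logb b ((q ^ T - q ^ r) / (q ^ i - q ^ r))) + rankGain b q n T i j := by
  rw [rankGain, ← rankMean_add, rankMean]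
  congr 1
  funext r
  rw [Finset.sum_range_succ]
  ring

theorem rankGain_two {q : ℝ} (hq : 1 < q) (n T i j : ℕ) :
    rankGain 2 q n T i j = Real.logb 2 q * rankGain q q n T i j := by
  rw [rankGain, rankGain, ← rankMean_const_mul]
  congr 1
  funext r
  have : Real.log q ≠ 0 := (Real.log_pos hq).ne'
  simp only [Real.logb]
  field_simp

theorem rateSum_eq_sum_rankGain (F : Type u) [Field F] [Fintype F] {m n T l : ℕ}
    (hT : min m n ≤ T) (hl : min n l ≤ min m n) :
    rateSum F m n T l =
      Real.logb 2 (Fintype.card F) *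
        ∑ j ∈ Finset.range l, rankGain (Fintype.card F) (Fintype.card F) n T (min m n) j := by
  have hq : (1 : ℝ) < Fintype.card F := by exact_mod_cast Fintype.one_lt_card
  have h : rateSum F m n T l = rankMean (Fintype.card F) n l (fun d => ∑ r ∈ Finset.range d,
      Real.logb 2 (((Fintype.card F : ℝ) ^ T - (Fintype.card F : ℝ) ^ r) /
        ((Fintype.card F : ℝ) ^ (min m n) - (Fintype.card F : ℝ) ^ r))) := by
    rw [rateSum, ← sum_psiNum_mul_gaussNum]
    refine Finset.sum_congr rfl fun d hd => ?_
    rw [Finset.mem_range] at hd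
    rw [logb_gaussNum_div (by omega) hT]
  rw [h, Finset.mul_sum]
  clear h hl
  induction l with
  | zero => simp [rankMean]
  | succ l ih => rw [rankMean_sum_logb_succ, ih, Finset.sum_range_succ, rankGain_two hq]

/-- The inequalities on the field size, as a condition on the real number `q`: an input of rank `l`
different from `min m n` does not gain more than it costs. -/
def GainInequalities (q : ℝ) (m n T : ℕ) : Prop :=
  (∀ l < min m n, (n : ℝ) * ((min m n : ℕ) - (l : ℝ)) ≤
    ∑ j ∈ Finset.Ico l (min m n), rankGain q q n T (min m n) j) ∧
  (∀ l, min m n + 1 ≤ l → l ≤ m →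
    ∑ j ∈ Finset.Ico (min m n) l, rankGain q q n T (min m n) j ≤
      (n : ℝ) * ((l : ℝ) - (min m n : ℕ)))

/-- The denominators in the inequalities are positive. Cleared of them, the inequalities say that
the rank `min m n` maximizes the divergence computed in `sum_transition_mul_logb`. -/
theorem satisfiesInequalities_iff_rateSum (F : Type u) [Field F] [Fintype F] {m n T : ℕ}
    (hn : 1 ≤ n) (hT : n + min m n < T) :
    SatisfiesInequalities F m n T ↔
      ∀ l ≤ m, rateSum F m n T l - n * l * Real.logb 2 (Fintype.card F) ≤
        rateSum F m n T (min m n) - n * (min m n : ℕ) * Real.logb 2 (Fintype.card F) := by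
  set L := Real.logb 2 (Fintype.card F) with hL
  have hTr : (n : ℝ) + (min m n : ℕ) < T := by exact_mod_cast hT
  have h1 : ∀ l < min m n, ((errorTerm F m n T l - errorTerm F m n T (min m n)) /
      (((T : ℝ) - n - (min m n : ℕ)) * ((min m n : ℕ) - (l : ℝ))) ≤ L ↔
      rateSum F m n T l - n * l * L ≤ rateSum F m n T (min m n) - n * (min m n : ℕ) * L) := by
    intro l hl
    have hlr : (l : ℝ) < (min m n : ℕ) := by exact_mod_cast hl
    rw [div_le_iff₀ (mul_pos (by linarith) (by linarith)), errorTerm, errorTerm,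
      min_eq_right (show l ≤ n by omega), min_eq_right (min_le_right m n), ← hL]
    constructor <;> intro h <;> linarith
  have h2 : ∀ l, min m n + 1 ≤ l → l ≤ m →
      ((errorTerm F m n T l - errorTerm F m n T (min m n)) /
      (((min m n : ℕ) : ℝ) * ((l : ℝ) - (min m n : ℕ))) ≤ L ↔
      rateSum F m n T l - n * l * L ≤ rateSum F m n T (min m n) - n * (min m n : ℕ) * L) := by
    intro l hl hlm
    have hlr : ((min m n : ℕ) : ℝ) < l := by exact_mod_cast hl
    have hi : ((min m n : ℕ) : ℝ) = n := by exact_mod_cast (show min m n = n by omega)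
    have hi0 : (0 : ℝ) < (min m n : ℕ) := by exact_mod_cast (show 0 < min m n by omega)
    rw [div_le_iff₀ (mul_pos hi0 (by linarith)), errorTerm, errorTerm,
      min_eq_left (show n ≤ l by omega), min_eq_right (min_le_right m n), hi, ← hL]
    constructor <;> intro h <;> linarith
  constructor
  · intro h l hl
    rcases lt_trichotomy l (min m n) with hlt | rfl | hgt
    · exact (h1 l hlt).1 (h.1 l hlt)
    · exact le_rfl
    · exact (h2 l hgt hl).1 (h.2 l hgt hl)
  · intro h
    exact ⟨fun l hl => (h1 l hl).2 (h l (by omega)), fun l hl hlm => (h2 l hl hlm).2 (h l hlm)⟩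

theorem satisfiesInequalities_iff_gain (F : Type u) [Field F] [Fintype F] {m n T : ℕ}
    (hn : 1 ≤ n) (hT : n + min m n < T) :
    SatisfiesInequalities F m n T ↔ GainInequalities (Fintype.card F) m n T := by
  rw [satisfiesInequalities_iff_rateSum F hn hT]
  have hq : (1 : ℝ) < Fintype.card F := by exact_mod_cast Fintype.one_lt_card
  have hL : 0 < Real.logb 2 (Fintype.card F) := Real.logb_pos one_lt_two hq
  rw [rateSum_eq_sum_rankGain F (by omega) (by omega)]
  have h1 : ∀ l < min m n, (rateSum F m n T l - n * l * Real.logb 2 (Fintype.card F) ≤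
      Real.logb 2 (Fintype.card F) * ∑ j ∈ Finset.range (min m n),
        rankGain (Fintype.card F) (Fintype.card F) n T (min m n) j -
        n * (min m n : ℕ) * Real.logb 2 (Fintype.card F) ↔
      (n : ℝ) * ((min m n : ℕ) - (l : ℝ)) ≤ ∑ j ∈ Finset.Ico l (min m n),
        rankGain (Fintype.card F) (Fintype.card F) n T (min m n) j) := by
    intro l hl
    rw [rateSum_eq_sum_rankGain F (by omega) (by omega), ← mul_le_mul_iff_right₀ hL (b := _ * _),
      ← Finset.sum_range_add_sum_Ico _ hl.le]
    constructor <;> intro h <;> linarith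
  have h2 : ∀ l, min m n + 1 ≤ l → l ≤ m →
      (rateSum F m n T l - n * l * Real.logb 2 (Fintype.card F) ≤
      Real.logb 2 (Fintype.card F) * ∑ j ∈ Finset.range (min m n),
        rankGain (Fintype.card F) (Fintype.card F) n T (min m n) j -
        n * (min m n : ℕ) * Real.logb 2 (Fintype.card F) ↔
      ∑ j ∈ Finset.Ico (min m n) l, rankGain (Fintype.card F) (Fintype.card F) n T (min m n) j ≤
      (n : ℝ) * ((l : ℝ) - (min m n : ℕ))) := by
    intro l hl hlm
    rw [rateSum_eq_sum_rankGain F (by omega) (by omega), ← mul_le_mul_iff_right₀ hL (c := _ * _),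
      ← Finset.sum_range_add_sum_Ico _ (show min m n ≤ l by omega)]
    constructor <;> intro h <;> linarith
  constructor
  · intro h
    exact ⟨fun l hl => (h1 l hl).1 (h l (by omega)), fun l hl hlm => (h2 l hl hlm).1 (h l hlm)⟩
  · intro h l hl
    rcases lt_trichotomy l (min m n) with hlt | rfl | hgt
    · exact (h1 l hlt).2 (h.1 l hlt)
    · rw [rateSum_eq_sum_rankGain F (by omega) (by omega)]
    · exact (h2 l hgt hl).2 (h.2 l hgt hl)

/-! ### The channel -/

theorem card_fiber_mul {F V W : Type*} [Field F] [Fintype F] [AddCommGroup V] [Module F V]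
    [Finite V] [AddCommGroup W] [Module F W] (f : V →ₗ[F] W) {y : W} (hy : y ∈ LinearMap.range f) :
    Nat.card {v // f v = y} * Fintype.card F ^ finrank F (LinearMap.range f) =
      Fintype.card F ^ finrank F V := by
  obtain ⟨v₀, rfl⟩ := hy
  have h : Nat.card {v // f v = f v₀} = Nat.card (LinearMap.ker f) :=
    Nat.card_congr ⟨fun v => ⟨v.1 - v₀, by simp [v.2]⟩, fun v => ⟨v.1 + v₀, by simp⟩,
      fun v => by simp, fun v => by simp⟩
  have := Fintype.ofFinite (LinearMap.ker f)
  rw [h, Nat.card_eq_fintype_card, Module.card_eq_pow_finrank (K := F), ← pow_add, add_comm,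
    LinearMap.finrank_range_add_finrank_ker]

section

variable {F : Type u} [Field F] {m n T : ℕ}

open Classical in
/-- The output is uniform over the matrices whose rows lie in the row space of the input. -/
theorem transition_eq [Fintype F] (X : Matrix (Fin m) (Fin T) F) (Y : Matrix (Fin n) (Fin T) F) :
    transition X Y =
      if rowSpace Y ≤ rowSpace X then ((Fintype.card F : ℝ) ^ (n * X.rank))⁻¹ else 0 := by
  have hq : (Fintype.card F : ℝ) ≠ 0 := by exact_mod_cast Fintype.card_ne_zero
  have hr : LinearMap.range X.vecMulLinear = rowSpace X := range_vecMulLinear X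
  have h1 : rowSpace Y ≤ rowSpace X ↔ ∀ i, Y i ∈ LinearMap.range X.vecMulLinear := by
    rw [hr, rowSpace, Submodule.span_le, Set.range_subset_iff]
    rfl
  have h2 : Nat.card {G : Matrix (Fin n) (Fin m) F // G * X = Y} =
      ∏ i, Nat.card {g : Fin m → F // X.vecMulLinear g = Y i} := by
    rw [← Nat.card_pi]
    refine Nat.card_congr ((Equiv.subtypeEquivRight fun G => ?_).trans
      (Equiv.subtypePiEquivPi (p := fun i g => X.vecMulLinear g = Y i)))
    exact funext_iff
  have h3 : (Nat.card (Matrix (Fin n) (Fin m) F) : ℝ) = (Fintype.card F : ℝ) ^ (n * m) := by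
    rw [Nat.card_eq_fintype_card, Module.card_eq_pow_finrank (K := F), finrank_matrix]
    simp [Fintype.card_fin]
  rw [transition, h2, h3]
  split_ifs with h
  · have h4 : ∀ i, (Nat.card {g : Fin m → F // X.vecMulLinear g = Y i} : ℝ) =
        (Fintype.card F : ℝ) ^ m / (Fintype.card F : ℝ) ^ X.rank := fun i => by
      have := card_fiber_mul X.vecMulLinear (h1.1 h i)
      rw [hr, finrank_rowSpace, finrank_fintype_fun_eq_card, Fintype.card_fin] at this
      rw [eq_div_iff (pow_ne_zero _ hq)]
      exact_mod_cast this
    rw [Nat.cast_prod, Finset.prod_congr rfl fun i _ => h4 i, Finset.prod_const, Finset.card_univ,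
      Fintype.card_fin, div_pow, ← pow_mul, ← pow_mul, mul_comm m, mul_comm X.rank]
    field_simp
  · rw [h1, not_forall] at h
    obtain ⟨i, hi⟩ := h
    have : Nat.card {g : Fin m → F // X.vecMulLinear g = Y i} = 0 := by
      rw [Nat.card_eq_zero]
      exact Or.inl ⟨fun g => hi ⟨g.1, g.2⟩⟩
    rw [Finset.prod_eq_zero (Finset.mem_univ i) this, Nat.cast_zero, zero_div]

theorem transition_nonneg (X : Matrix (Fin m) (Fin T) F) (Y : Matrix (Fin n) (Fin T) F) :
    0 ≤ transition X Y := by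
  unfold transition
  positivity

theorem sum_transition [Fintype F] (X : Matrix (Fin m) (Fin T) F) :
    ∑ Y : Matrix (Fin n) (Fin T) F, transition X Y = 1 := by
  classical
  have h1 := sum_psiNum_mul_gaussNum (F := F) n X.rank fun _ => 1
  have h2 := sum_rowSpace_le n (rowSpace X) fun _ => 1
  rw [rankMean_const] at h1
  rw [finrank_rowSpace] at h2
  rw [Finset.sum_congr rfl fun Y _ => transition_eq X Y, ← Finset.sum_filter, ← h1,
    ← mul_one (_⁻¹ : ℝ), ← Finset.mul_sum, h2, Finset.mul_sum]
  exact Finset.sum_congr rfl fun d _ => by ring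

/-- Every output distribution `Q` charging all reachable outputs bounds the mutual information by
the largest divergence of a row of the channel from `Q`. -/
theorem mutualInformation_le [Fintype F] (Q : Matrix (Fin n) (Fin T) F → ℝ) (hQ0 : ∀ Y, 0 ≤ Q Y)
    (hQ1 : ∑ Y, Q Y = 1)
    (hQ : ∀ (X : Matrix (Fin m) (Fin T) F) Y, transition X Y ≠ 0 → Q Y ≠ 0) {C : ℝ}
    (hC : ∀ X : Matrix (Fin m) (Fin T) F,
      ∑ Y, transition X Y * Real.logb 2 (transition X Y / Q Y) ≤ C)
    {P : Matrix (Fin m) (Fin T) F → ℝ} (hP : P ∈ inputDistributions F m T) :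
    mutualInformation n P ≤ C := by
  have hl2 : 0 < Real.log 2 := Real.log_pos one_lt_two
  set O : Matrix (Fin n) (Fin T) F → ℝ := outputDistribution P with hO
  have hO0 : ∀ Y, 0 ≤ O Y := fun Y =>
    Finset.sum_nonneg fun X _ => mul_nonneg (hP.1 X) (transition_nonneg X Y)
  have hterm : ∀ X Y, P X * transition X Y * Real.logb 2 (transition X Y / O Y) ≤
      P X * (transition X Y * Real.logb 2 (transition X Y / Q Y)) +
        (P X * transition X Y * (Q Y / O Y) - P X * transition X Y) / Real.log 2 := by
    intro X Y
    have hPt : 0 ≤ P X * transition X Y := mul_nonneg (hP.1 X) (transition_nonneg X Y)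
    rcases hPt.eq_or_lt with h0 | hpos
    · rw [← mul_assoc, ← h0]
      simp
    · have ht : 0 < transition X Y := by
        rcases (transition_nonneg X Y).eq_or_lt with h | h
        · rw [← h, mul_zero] at hpos
          exact absurd hpos (lt_irrefl _)
        · exact h
      have hq : 0 < Q Y := (hQ0 Y).lt_of_ne' (hQ X Y ht.ne')
      have ho : 0 < O Y := hpos.trans_le
        (Finset.single_le_sum (f := fun X => P X * transition X Y)
          (fun X _ => mul_nonneg (hP.1 X) (transition_nonneg X Y)) (Finset.mem_univ X))
      have h1 : Real.logb 2 (transition X Y / O Y) =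
          Real.logb 2 (transition X Y / Q Y) + Real.logb 2 (Q Y / O Y) := by
        rw [← Real.logb_mul (by positivity) (by positivity)]
        congr 1
        field_simp
      -- the inequality of Gibbs, from `log z ≤ z - 1`
      have h2 : Real.logb 2 (Q Y / O Y) ≤ (Q Y / O Y - 1) / Real.log 2 :=
        div_le_div_of_nonneg_right (Real.log_le_sub_one_of_pos (by positivity)) hl2.le
      rw [h1]
      have h3 := mul_le_mul_of_nonneg_left h2 hpos.le
      calc _ = P X * (transition X Y * Real.logb 2 (transition X Y / Q Y)) +
            P X * transition X Y * Real.logb 2 (Q Y / O Y) := by ring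
        _ ≤ _ := add_le_add le_rfl (h3.trans_eq (by ring))
  have hsum1 : ∑ X, ∑ Y : Matrix (Fin n) (Fin T) F, P X * transition X Y = 1 := by
    simp_rw [← Finset.mul_sum, sum_transition, mul_one]
    exact hP.2
  have hsum2 : ∑ X, ∑ Y, P X * transition X Y * (Q Y / O Y) ≤ 1 := by
    rw [Finset.sum_comm, ← hQ1]
    refine Finset.sum_le_sum fun Y _ => ?_
    rw [← Finset.sum_mul]
    change O Y * (Q Y / O Y) ≤ Q Y
    rcases (hO0 Y).eq_or_lt with h | h
    · rw [← h, zero_mul]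
      exact hQ0 Y
    · rw [mul_div_cancel₀ _ h.ne']
  calc mutualInformation n P ≤ ∑ X, ∑ Y,
        (P X * (transition X Y * Real.logb 2 (transition X Y / Q Y)) +
        (P X * transition X Y * (Q Y / O Y) - P X * transition X Y) / Real.log 2) :=
        Finset.sum_le_sum fun X _ => Finset.sum_le_sum fun Y _ => hterm X Y
    _ = ∑ X, P X * ∑ Y, transition X Y * Real.logb 2 (transition X Y / Q Y) +
        (∑ X, ∑ Y, P X * transition X Y * (Q Y / O Y) -
          ∑ X, ∑ Y : Matrix (Fin n) (Fin T) F, P X * transition X Y) / Real.log 2 := by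
        simp_rw [Finset.sum_add_distrib, ← Finset.sum_div, Finset.sum_sub_distrib, Finset.mul_sum]
    _ ≤ ∑ X, P X * C + 0 := by
        refine add_le_add (Finset.sum_le_sum fun X _ =>
          mul_le_mul_of_nonneg_left (hC X) (hP.1 X)) ?_
        exact div_nonpos_of_nonpos_of_nonneg (by linarith) hl2.le
    _ = C := by rw [← Finset.sum_mul, hP.2, one_mul, add_zero]

end

/-! ### Optimality of uniformly distributed row spaces -/

section

variable {F : Type u} [Field F] {m n T : ℕ}

/-- A choice of one matrix for each subspace of dimension `i`. -/
theorem exists_bijOn_rowSpace {i : ℕ} (him : i ≤ m) :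
    ∃ C : Set (Matrix (Fin m) (Fin T) F), Set.BijOn rowSpace C (grassmannian F T i) := by
  refine (Set.SurjOn.exists_bijOn_subset (s := Set.univ) (f := rowSpace) fun π hπ => ?_).imp
    fun C hC => hC.2
  have hπ' : finrank F π = i := hπ
  let b := finBasisOfFinrankEq F π hπ'
  refine ⟨Matrix.of fun j => if h : j.1 < i then (b ⟨j.1, h⟩ : Fin T → F) else 0, trivial, ?_⟩
  apply le_antisymm
  · rw [rowSpace, Submodule.span_le]
    rintro _ ⟨j, rfl⟩
    change (if h : j.1 < i then (b ⟨j.1, h⟩ : Fin T → F) else 0) ∈ π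
    split_ifs
    · exact Submodule.coe_mem _
    · exact zero_mem _
  · have h1 : π = Submodule.span F (Set.range fun k => (b k : Fin T → F)) := by
      have := congrArg (Submodule.map π.subtype) b.span_eq
      rw [Submodule.map_span, Submodule.map_top, Submodule.range_subtype, ← Set.range_comp] at this
      exact this.symm
    refine h1.le.trans (Submodule.span_le.2 ?_)
    rintro _ ⟨k, rfl⟩
    refine Submodule.subset_span ⟨⟨k.1, k.2.trans_le him⟩, ?_⟩
    change (if h : k.1 < i then (b ⟨k.1, h⟩ : Fin T → F) else 0) = _
    rw [dif_pos k.2]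

variable [Fintype F]

/-- The output distribution of an input whose row space is uniform over the subspaces of dimension
`i`: the output `Y` is reached from the subspaces containing its rows. -/
noncomputable def grassmannianOutput (i : ℕ) (Y : Matrix (Fin n) (Fin T) F) : ℝ :=
  (Nat.card {U : Submodule F (Fin T → F) // rowSpace Y ≤ U ∧ finrank F U = i} : ℝ) /
    gaussNum F T i * ((Fintype.card F : ℝ) ^ (n * i))⁻¹

theorem grassmannianOutput_eq {i : ℕ} (hi : i ≤ T) (Y : Matrix (Fin n) (Fin T) F)
    (hY : Y.rank ≤ i) :
    grassmannianOutput i Y = (gaussNum F i Y.rank : ℝ) / gaussNum F T Y.rank *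
      ((Fintype.card F : ℝ) ^ (n * i))⁻¹ := by
  have h1 : (gaussNum F T i : ℝ) ≠ 0 := by exact_mod_cast (gaussNum_pos hi).ne'
  have h2 : (gaussNum F T Y.rank : ℝ) ≠ 0 := by exact_mod_cast (gaussNum_pos (hY.trans hi)).ne'
  have h3 : (gaussNum F T Y.rank : ℝ) * gaussNum F (T - Y.rank) (i - Y.rank) =
      gaussNum F T i * gaussNum F i Y.rank := by exact_mod_cast card_flags hY
  rw [grassmannianOutput, card_ge_submodule_finrank _ (by rwa [finrank_rowSpace]), finrank_rowSpace]
  congr 1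
  rw [div_eq_div_iff h1 h2]
  linarith

/-- The divergence from `grassmannianOutput` of the output of a given input `X` depends only on the
rank of `X`. -/
theorem sum_transition_mul_logb (hT : min m n ≤ T) (X : Matrix (Fin m) (Fin T) F) :
    ∑ Y : Matrix (Fin n) (Fin T) F, transition X Y *
      Real.logb 2 (transition X Y / grassmannianOutput (min m n) Y) =
      rateSum F m n T X.rank - n * X.rank * Real.logb 2 (Fintype.card F) +
        n * (min m n : ℕ) * Real.logb 2 (Fintype.card F) := by
  classical
  set q : ℝ := (Fintype.card F : ℝ) with hqdef
  set l := X.rank with hl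
  have hlm : l ≤ m := X.rank_le_height
  let f : ℕ → ℝ := fun d => (q ^ (n * l))⁻¹ *
    (Real.logb 2 ((gaussNum F T d : ℝ) / (gaussNum F (min m n) d : ℝ)) -
      n * l * Real.logb 2 q + n * (min m n : ℕ) * Real.logb 2 q)
  have h1 : ∀ Y : Matrix (Fin n) (Fin T) F, transition X Y *
      Real.logb 2 (transition X Y / grassmannianOutput (min m n) Y) =
      if rowSpace Y ≤ rowSpace X then f Y.rank else 0 := by
    intro Y
    rw [transition_eq]
    split_ifs with h
    · have hr : Y.rank ≤ min m n := by
        have h1 := Submodule.finrank_mono h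
        rw [finrank_rowSpace, finrank_rowSpace] at h1
        exact le_min (h1.trans hlm) Y.rank_le_height
      have h2 : (gaussNum F T Y.rank : ℝ) ≠ 0 := by
        exact_mod_cast (gaussNum_pos (hr.trans hT)).ne'
      have h3 : (gaussNum F (min m n) Y.rank : ℝ) ≠ 0 := by exact_mod_cast (gaussNum_pos hr).ne'
      rw [grassmannianOutput_eq hT Y hr]
      have h4 : (q ^ (n * l))⁻¹ / ((gaussNum F (min m n) Y.rank : ℝ) / gaussNum F T Y.rank *
          (q ^ (n * min m n))⁻¹) = (gaussNum F T Y.rank : ℝ) / gaussNum F (min m n) Y.rank *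
          (q ^ (n * l))⁻¹ * q ^ (n * min m n) := by
        field_simp
      rw [← hqdef, ← hl, h4, Real.logb_mul (by positivity) (by positivity),
        Real.logb_mul (by positivity) (by positivity), Real.logb_inv, Real.logb_pow,
        Real.logb_pow]
      simp only [f]
      push_cast
      ring
    · rw [zero_mul]
  have h5 := sum_psiNum_mul_gaussNum (F := F) n l fun _ => 1
  rw [rankMean_const, ← hqdef] at h5
  rw [Finset.sum_congr rfl fun Y _ => h1 Y, ← Finset.sum_filter, sum_rowSpace_le, finrank_rowSpace,
    ← hl, rateSum, ← hqdef, sub_add,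
    ← one_mul (n * l * Real.logb 2 q - n * (min m n : ℕ) * Real.logb 2 q), ← h5, Finset.sum_mul,
    ← Finset.sum_sub_distrib]
  refine Finset.sum_congr rfl fun d _ => ?_
  simp only [f]
  ring

theorem sum_rowSpaceLaw_mul (P : Matrix (Fin m) (Fin T) F → ℝ)
    [Fintype (Submodule F (Fin T → F))] (f : Submodule F (Fin T → F) → ℝ) :
    ∑ X, P X * f (rowSpace X) = ∑ π, rowSpaceLaw P π * f π := by
  classical
  rw [← Finset.sum_fiberwise (s := Finset.univ) (g := fun X : Matrix (Fin m) (Fin T) F =>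
    rowSpace X)]
  refine Finset.sum_congr rfl fun π _ => ?_
  rw [rowSpaceLaw, Finset.sum_mul]
  refine Finset.sum_congr ?_ fun X hX => ?_
  · ext
    simp
  · rw [(Finset.mem_filter.1 hX).2]

theorem rowSpaceLaw_eq_zero {i : ℕ} (hi : i ≤ T) {P : Matrix (Fin m) (Fin T) F → ℝ}
    (hP : P ∈ inputDistributions F m T)
    (hlaw : ∀ π ∈ grassmannian F T i, rowSpaceLaw P π = (gaussNum F T i : ℝ)⁻¹)
    {π : Submodule F (Fin T → F)} (hπ : finrank F π ≠ i) : rowSpaceLaw P π = 0 := by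
  classical
  have := Fintype.ofFinite (Submodule F (Fin T → F))
  have h0 : ∀ π, 0 ≤ rowSpaceLaw P π := fun π => Finset.sum_nonneg fun X _ => hP.1 X
  have h2 : ∀ π ∈ Finset.univ.filter fun π : Submodule F (Fin T → F) => finrank F π = i,
      rowSpaceLaw P π = (gaussNum F T i : ℝ)⁻¹ := fun π hπ => hlaw π (Finset.mem_filter.1 hπ).2
  have h1 := sum_rowSpaceLaw_mul P fun _ => 1
  simp only [mul_one] at h1
  rw [hP.2, ← Finset.sum_filter_add_sum_filter_not _ fun π : Submodule F (Fin T → F) => finrank F π = i,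
    Finset.sum_congr rfl h2, Finset.sum_const, ← Fintype.card_subtype, nsmul_eq_mul, ← Nat.card_eq_fintype_card] at h1
  change 1 = (gaussNum F T i : ℝ) * _ + _ at h1
  -- the subspaces of dimension `i` already carry the total mass
  rw [mul_inv_cancel₀ (by exact_mod_cast (gaussNum_pos hi).ne'), eq_comm, add_eq_left] at h1
  exact (Finset.sum_eq_zero_iff_of_nonneg fun π _ => h0 π).1 h1 π (by simpa using hπ)

theorem rank_eq_of_ne_zero {i : ℕ} (hi : i ≤ T) {P : Matrix (Fin m) (Fin T) F → ℝ}
    (hP : P ∈ inputDistributions F m T)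
    (hlaw : ∀ π ∈ grassmannian F T i, rowSpaceLaw P π = (gaussNum F T i : ℝ)⁻¹)
    {X : Matrix (Fin m) (Fin T) F} (hX : P X ≠ 0) : X.rank = i := by
  by_contra h
  have h1 := rowSpaceLaw_eq_zero hi hP hlaw (π := rowSpace X) (by rwa [finrank_rowSpace])
  rw [rowSpaceLaw, Finset.sum_eq_zero_iff_of_nonneg fun X _ => hP.1 X] at h1
  exact hX (h1 X (by simp))

theorem outputDistribution_eq {i : ℕ} (hi : i ≤ T) {P : Matrix (Fin m) (Fin T) F → ℝ}
    (hP : P ∈ inputDistributions F m T)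
    (hlaw : ∀ π ∈ grassmannian F T i, rowSpaceLaw P π = (gaussNum F T i : ℝ)⁻¹)
    (Y : Matrix (Fin n) (Fin T) F) : outputDistribution P Y = grassmannianOutput i Y := by
  classical
  have := Fintype.ofFinite (Submodule F (Fin T → F))
  have h1 : ∀ X : Matrix (Fin m) (Fin T) F, transition X Y = if rowSpace Y ≤ rowSpace X then
      ((Fintype.card F : ℝ) ^ (n * finrank F (rowSpace X)))⁻¹ else 0 := fun X => by
    rw [transition_eq, finrank_rowSpace]
  rw [outputDistribution, Finset.sum_congr rfl fun X _ => by rw [h1 X], sum_rowSpaceLaw_mul P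
    fun π => if rowSpace Y ≤ π then ((Fintype.card F : ℝ) ^ (n * finrank F π))⁻¹ else 0]
  have h2 : ∀ π : Submodule F (Fin T → F), rowSpaceLaw P π * (if rowSpace Y ≤ π then
      ((Fintype.card F : ℝ) ^ (n * finrank F π))⁻¹ else 0) =
      if rowSpace Y ≤ π ∧ finrank F π = i then
        (gaussNum F T i : ℝ)⁻¹ * ((Fintype.card F : ℝ) ^ (n * i))⁻¹ else 0 := by
    intro π
    by_cases hπ : finrank F π = i
    · simp only [hlaw π hπ, hπ, and_true, mul_ite, mul_zero]
    · simp only [rowSpaceLaw_eq_zero hi hP hlaw hπ, hπ, and_false, if_false, zero_mul]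
  rw [Finset.sum_congr rfl fun π _ => h2 π, ← Finset.sum_filter, Finset.sum_const,
    ← Fintype.card_subtype, ← Nat.card_eq_fintype_card, nsmul_eq_mul, grassmannianOutput]
  ring

theorem uniformOn_mem {i : ℕ} (hi : i ≤ T) {C : Set (Matrix (Fin m) (Fin T) F)}
    (hC : Set.BijOn rowSpace C (grassmannian F T i)) :
    uniformOn C ∈ inputDistributions F m T ∧
      ∀ π ∈ grassmannian F T i, rowSpaceLaw (uniformOn C) π = (gaussNum F T i : ℝ)⁻¹ := by
  classical
  have hcard : C.ncard = gaussNum F T i := by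
    rw [gaussNum, ← hC.image_eq, ← hC.injOn.ncard_image]
    rfl
  have h0 : (gaussNum F T i : ℝ) ≠ 0 := by exact_mod_cast (gaussNum_pos hi).ne'
  refine ⟨⟨fun X => Set.indicator_nonneg (fun _ _ => by positivity) X, ?_⟩, fun π hπ => ?_⟩
  · rw [uniformOn, ← Finset.sum_filter_add_sum_filter_not _ fun X => X ∈ C]
    rw [Finset.sum_congr rfl fun X hX => Set.indicator_of_mem (Finset.mem_filter.1 hX).2 _,
      Finset.sum_congr rfl fun X hX => Set.indicator_of_notMem (Finset.mem_filter.1 hX).2 _,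
      Finset.sum_const, Finset.sum_const_zero, add_zero, nsmul_eq_mul, ← Fintype.card_subtype,
      ← Nat.card_eq_fintype_card]
    change (C.ncard : ℝ) * _ = 1
    rw [hcard, mul_inv_cancel₀ h0]
  · obtain ⟨X, hX, rfl⟩ := hC.surjOn hπ
    rw [rowSpaceLaw, Finset.sum_eq_single X]
    · rw [uniformOn, Set.indicator_of_mem hX, hcard]
    · intro Z hZ hZX
      refine Set.indicator_of_notMem (fun hZC => hZX ?_) _
      exact hC.injOn hZC hX (Finset.mem_filter.1 hZ).2
    · simp

theorem mutualInformation_eq_rateSum (hT : min m n ≤ T) {P : Matrix (Fin m) (Fin T) F → ℝ}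
    (hP : P ∈ inputDistributions F m T)
    (hlaw : ∀ π ∈ grassmannian F T (min m n),
      rowSpaceLaw P π = (gaussNum F T (min m n) : ℝ)⁻¹) :
    mutualInformation n P = rateSum F m n T (min m n) := by
  have h : ∀ X : Matrix (Fin m) (Fin T) F, ∑ Y : Matrix (Fin n) (Fin T) F,
      P X * transition X Y * Real.logb 2 (transition X Y / outputDistribution P Y) =
      P X * rateSum F m n T (min m n) := by
    intro X
    simp_rw [outputDistribution_eq hT hP hlaw, mul_assoc, ← Finset.mul_sum]
    rcases eq_or_ne (P X) 0 with h0 | h0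
    · rw [h0, zero_mul, zero_mul]
    · rw [sum_transition_mul_logb hT, rank_eq_of_ne_zero hT hP hlaw h0]
      ring
  rw [mutualInformation, Finset.sum_congr rfl fun X _ => h X, ← Finset.sum_mul, hP.2, one_mul]

theorem mutualInformation_le_rateSum (hn : 1 ≤ n) (hT : n + min m n < T)
    (h : SatisfiesInequalities F m n T) {P : Matrix (Fin m) (Fin T) F → ℝ}
    (hP : P ∈ inputDistributions F m T) :
    mutualInformation n P ≤ rateSum F m n T (min m n) := by
  have hiT : min m n ≤ T := by omega
  obtain ⟨C, hC⟩ := exists_bijOn_rowSpace (F := F) (T := T) (min_le_left m n)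
  obtain ⟨hmem, hlaw⟩ := uniformOn_mem hiT hC
  have hout := outputDistribution_eq (n := n) hiT hmem hlaw
  refine mutualInformation_le (grassmannianOutput (min m n)) (fun Y => ?_) ?_ (fun X Y hXY => ?_)
    (fun X => ?_) hP
  · rw [grassmannianOutput]
    positivity
  · simp_rw [← hout, outputDistribution]
    rw [Finset.sum_comm]
    simp_rw [← Finset.mul_sum, sum_transition, mul_one]
    exact hmem.2
  · classical
    rw [transition_eq, ne_eq, ite_eq_right_iff, Classical.not_imp] at hXY
    have h1 := Submodule.finrank_mono hXY.1
    rw [finrank_rowSpace, finrank_rowSpace] at h1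
    have hr : Y.rank ≤ min m n := le_min (h1.trans X.rank_le_height) Y.rank_le_height
    have h2 : (gaussNum F T Y.rank : ℝ) ≠ 0 := by
      exact_mod_cast (gaussNum_pos (hr.trans hiT)).ne'
    have h3 : (gaussNum F (min m n) Y.rank : ℝ) ≠ 0 := by exact_mod_cast (gaussNum_pos hr).ne'
    rw [grassmannianOutput_eq hiT Y hr]
    positivity
  · rw [sum_transition_mul_logb hiT]
    have := (satisfiesInequalities_iff_rateSum F hn hT).1 h X.rank X.rank_le_height
    linarith

/-- The inequalities on the field size are the Karush-Kuhn-Tucker conditions for the inputs with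
uniform row space: under them these inputs are optimal. -/
theorem capacity_eq_rateSum (hn : 1 ≤ n) (hT : n + min m n < T)
    (h : SatisfiesInequalities F m n T) :
    IsGreatest (mutualInformation n '' inputDistributions F m T) (rateSum F m n T (min m n)) ∧
      capacity F m n T = rateSum F m n T (min m n) := by
  have hiT : min m n ≤ T := by omega
  obtain ⟨C, hC⟩ := exists_bijOn_rowSpace (F := F) (T := T) (min_le_left m n)
  obtain ⟨hmem, hlaw⟩ := uniformOn_mem hiT hC
  have hg : IsGreatest (mutualInformation n '' inputDistributions F m T)
      (rateSum F m n T (min m n)) := by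
    refine ⟨⟨_, hmem, mutualInformation_eq_rateSum hiT hmem hlaw⟩, ?_⟩
    rintro _ ⟨P, hP, rfl⟩
    exact mutualInformation_le_rateSum hn hT h hP
  exact ⟨hg, hg.csSup_eq⟩

end

/-! ### The probability that a new column does not raise the rank -/

section

variable {q : ℝ} {n j : ℕ}

/-- The expected number of nonzero vectors orthogonal to all columns of a random matrix. -/
theorem rankMean_sub_one (hq : 0 < q) (n j : ℕ) :
    rankMean q n j (fun r => q ^ n / q ^ r - 1) = (q ^ n - 1) / q ^ j := by
  induction j with
  | zero => simp [rankMean]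
  | succ j ih =>
    rw [rankMean, pow_succ, ← div_div, ← ih, div_eq_inv_mul, ← rankMean_const_mul]
    congr 1
    funext r
    field_simp
    ring

/-- The expected number of linearly independent pairs of vectors orthogonal to all columns of a
random matrix. -/
theorem rankMean_sub_one_mul_sub (hq : 0 < q) (n j : ℕ) :
    rankMean q n j (fun r => (q ^ n / q ^ r - 1) * (q ^ n / q ^ r - q)) =
      (q ^ n - 1) * (q ^ n - q) / (q ^ j) ^ 2 := by
  induction j with
  | zero => simp [rankMean]
  | succ j ih =>
    rw [rankMean, pow_succ q j, mul_pow, ← div_div, ← ih, div_eq_inv_mul, ← rankMean_const_mul]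
    congr 1
    funext r
    field_simp
    ring

/-- The probability that a random new column does not raise the rank of a random `n × j` matrix. -/
noncomputable def stallProb (q : ℝ) (n j : ℕ) : ℝ := rankMean q n j fun r => q ^ r / q ^ n

theorem rankMean_one_sub (q : ℝ) (n j : ℕ) :
    rankMean q n j (fun r => 1 - q ^ r / q ^ n) = 1 - stallProb q n j := by
  have h := rankMean_add q n j (fun _ => 1) (fun r => -1 * (q ^ r / q ^ n))
  rw [rankMean_const, rankMean_const_mul, ← stallProb] at h
  linarith [h, show rankMean q n j (fun r => 1 - q ^ r / q ^ n) =
    rankMean q n j (fun r => 1 + -1 * (q ^ r / q ^ n)) by congr 1; funext r; ring]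

theorem stallProb_nonneg (hq : 1 ≤ q) (n j : ℕ) : 0 ≤ stallProb q n j := by
  rw [← rankMean_const q n j 0]
  exact rankMean_mono hq fun r _ _ => by positivity

theorem stallProb_le_one (hq : 1 ≤ q) (n j : ℕ) : stallProb q n j ≤ 1 := by
  rw [← rankMean_const q n j 1]
  exact rankMean_mono hq fun r hr _ =>
    div_le_one_of_le₀ (pow_le_pow_right₀ hq hr) (by positivity)

theorem stallProb_le (hq : 1 ≤ q) (hj : j ≤ n) : stallProb q n j ≤ 1 / q ^ (n - j) := by
  rw [← rankMean_const q n j (1 / q ^ (n - j))]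
  refine rankMean_mono hq fun r hr hrj => ?_
  rw [div_le_div_iff₀ (by positivity) (by positivity), ← pow_add, one_mul]
  exact pow_le_pow_right₀ hq (by omega)

theorem pow_div_pow_eq (hq : 0 < q) {r n : ℕ} (h : r ≤ n) : q ^ n / q ^ r = q ^ (n - r) := by
  rw [div_eq_iff (by positivity), ← pow_add, Nat.sub_add_cancel h]

/-- Powers of `q` do not lie strictly between two consecutive powers of `q`. -/
theorem mul_sub_pow_nonneg (hq : 1 ≤ q) (s t : ℕ) : 0 ≤ (q ^ t - q ^ s) * (q ^ t - q ^ (s + 1)) := by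
  rcases le_or_gt t s with h | h
  · exact mul_nonneg_of_nonpos_of_nonpos (sub_nonpos.2 (pow_le_pow_right₀ hq h))
      (sub_nonpos.2 (pow_le_pow_right₀ hq (by omega)))
  · exact mul_nonneg (sub_nonneg.2 (pow_le_pow_right₀ hq h.le))
      (sub_nonneg.2 (pow_le_pow_right₀ hq h))

/-- The chord of `Q ↦ 1 / Q` through `q ^ s` and `q ^ (s + 1)` bounds the function from below at all
powers of `q`. -/
theorem le_stallProb (hq : 1 < q) (hj : j ≤ n) :
    1 / q ^ (n - j) - 1 / q ^ (2 * (n - j) + 1) * (1 - 1 / q ^ j) ≤ stallProb q n j := by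
  have hq0 : 0 < q := by linarith
  obtain ⟨s, rfl⟩ := Nat.exists_eq_add_of_le hj
  rw [Nat.add_sub_cancel_left]
  have h1 := rankMean_sub_one hq0 (j + s) j
  have h2 : rankMean q (j + s) j (fun r => 1 / q ^ s + 1 / q ^ (s + 1) - 1 / q ^ (2 * s + 1) +
      -(1 / q ^ (2 * s + 1)) * (q ^ (j + s) / q ^ r - 1)) ≤ stallProb q (j + s) j := by
    refine rankMean_mono hq.le fun r hr _ => ?_
    have h := mul_sub_pow_nonneg hq.le s (j + s - r)
    have hy : q ^ r / q ^ (j + s) = 1 / q ^ (j + s - r) := by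
      rw [← pow_div_pow_eq hq0 hr, one_div_div]
    rw [hy, pow_div_pow_eq hq0 hr]
    set Q := q ^ (j + s - r) with hQ
    have hQ0 : 0 < Q := by positivity
    have e : 1 / Q - (1 / q ^ s + 1 / q ^ (s + 1) - 1 / q ^ (2 * s + 1) +
        -(1 / q ^ (2 * s + 1)) * (Q - 1)) =
        (Q - q ^ s) * (Q - q ^ (s + 1)) / (Q * (q ^ s) ^ 2 * q) := by
      rw [two_mul, pow_succ, pow_succ, pow_add]
      field_simp
      ring
    rw [← sub_nonneg, e]
    positivity
  rw [rankMean_add, rankMean_const, rankMean_const_mul, h1] at h2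
  refine le_of_eq_of_le ?_ h2
  rw [two_mul, pow_succ, pow_succ, pow_add, pow_add]
  field_simp
  ring

/-- The interpolation of `Q ↦ 1 / Q` at `q`, `q ^ 2` and `q ^ 3` bounds the function from above at
all powers of `q`. -/
theorem stallProb_pred_le (hq : 1 < q) (j : ℕ) :
    stallProb q (j + 1) j ≤
      1 / q - 1 / q ^ 3 * (1 - 1 / q ^ j) + 1 / q ^ 6 * (1 - 1 / q ^ j) * (1 - q / q ^ j) := by
  have hq0 : 0 < q := by linarith
  have h1 := rankMean_sub_one hq0 (j + 1) j
  have h1' := rankMean_sub_one_mul_sub hq0 (j + 1) j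
  have h2 : stallProb q (j + 1) j ≤ rankMean q (j + 1) j (fun r =>
      (1 / q + 1 / q ^ 2 - 1 / q ^ 3 - (q ^ 2 - 1) * (1 - q) / q ^ 6) +
      (-(1 / q ^ 3) - (q ^ 2 - 1) / q ^ 6) * (q ^ (j + 1) / q ^ r - 1) + 1 / q ^ 6 *
        ((q ^ (j + 1) / q ^ r - 1) * (q ^ (j + 1) / q ^ r - q))) := by
    refine rankMean_mono hq.le fun r hr hrj => ?_
    have hy : q ^ r / q ^ (j + 1) = 1 / q ^ (j + 1 - r) := by
      rw [← pow_div_pow_eq hq0 hr, one_div_div]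
    rw [hy, pow_div_pow_eq hq0 hr]
    set Q := q ^ (j + 1 - r) with hQ
    have hQ0 : 0 < Q := by positivity
    have h : 0 ≤ (Q - q) * ((Q - q ^ 2) * (Q - q ^ 3)) :=
      mul_nonneg (sub_nonneg.2 (le_self_pow₀ hq.le (by omega)))
        (mul_sub_pow_nonneg hq.le 2 (j + 1 - r))
    have e : (1 / q + 1 / q ^ 2 - 1 / q ^ 3 - (q ^ 2 - 1) * (1 - q) / q ^ 6) +
      (-(1 / q ^ 3) - (q ^ 2 - 1) / q ^ 6) * (Q - 1) + 1 / q ^ 6 * ((Q - 1) * (Q - q)) - 1 / Q =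
        (Q - q) * ((Q - q ^ 2) * (Q - q ^ 3)) / (Q * q ^ 6) := by
      field_simp
      ring
    rw [← sub_nonneg, e]
    positivity
  rw [rankMean_add, rankMean_add, rankMean_const, rankMean_const_mul, rankMean_const_mul, h1,
    h1'] at h2
  refine h2.trans_eq ?_
  rw [pow_succ q j]
  field_simp
  ring

/-- The chord of `Q ↦ 1 / Q` through `1` and `q`, for matrices with at least as many columns as
rows. -/
theorem one_sub_stallProb_le (hq : 1 < q) (n k : ℕ) :
    1 - stallProb q n (n + k) ≤ 1 / q ^ (k + 1) * (1 - 1 / q ^ n) := by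
  have hq0 : 0 < q := by linarith
  have h1 := rankMean_sub_one hq0 n (n + k)
  have h2 : rankMean q n (n + k) (fun r => 1 - q ^ r / q ^ n) ≤
      rankMean q n (n + k) (fun r => 1 / q * (q ^ n / q ^ r - 1)) := by
    refine rankMean_mono hq.le fun r hr _ => ?_
    have hy : q ^ r / q ^ n = 1 / q ^ (n - r) := by rw [← pow_div_pow_eq hq0 hr, one_div_div]
    rw [hy, pow_div_pow_eq hq0 hr]
    set Q := q ^ (n - r) with hQ
    have hQ0 : 0 < Q := by positivity
    have h := mul_sub_pow_nonneg hq.le 0 (n - r)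
    rw [pow_zero, zero_add, pow_one, ← hQ] at h
    have e : 1 / q * (Q - 1) - (1 - 1 / Q) = (Q - 1) * (Q - q) / (Q * q) := by
      field_simp
    rw [← sub_nonneg, e]
    positivity
  rw [rankMean_const_mul, h1, rankMean_one_sub] at h2
  refine h2.trans_eq ?_
  rw [pow_succ, pow_add]
  field_simp

/-- The interpolation of `Q ↦ 1 / Q` at `1`, `q` and `q ^ 2`, for matrices with at least as many
columns as rows. -/
theorem le_one_sub_stallProb (hq : 1 < q) (n k : ℕ) :
    1 / q ^ (k + 1) * (1 - 1 / q ^ n) * (1 - 1 / q ^ (k + 2) * (1 - q / q ^ n)) ≤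
      1 - stallProb q n (n + k) := by
  have hq0 : 0 < q := by linarith
  have h1 := rankMean_sub_one hq0 n (n + k)
  have h1' := rankMean_sub_one_mul_sub hq0 n (n + k)
  have h2 : rankMean q n (n + k) (fun r => 1 / q * (q ^ n / q ^ r - 1) +
      -(1 / q ^ 3) * ((q ^ n / q ^ r - 1) * (q ^ n / q ^ r - q))) ≤
      rankMean q n (n + k) (fun r => 1 - q ^ r / q ^ n) := by
    refine rankMean_mono hq.le fun r hr _ => ?_
    have hy : q ^ r / q ^ n = 1 / q ^ (n - r) := by rw [← pow_div_pow_eq hq0 hr, one_div_div]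
    rw [hy, pow_div_pow_eq hq0 hr]
    set Q := q ^ (n - r) with hQ
    have hQ0 : 0 < Q := by positivity
    have h : 0 ≤ (Q - 1) * ((Q - q) * (Q - q ^ 2)) := by
      refine mul_nonneg (sub_nonneg.2 (one_le_pow₀ hq.le)) ?_
      simpa using mul_sub_pow_nonneg hq.le 1 (n - r)
    have e : (1 - 1 / Q) - (1 / q * (Q - 1) + -(1 / q ^ 3) * ((Q - 1) * (Q - q))) =
        (Q - 1) * ((Q - q) * (Q - q ^ 2)) / (Q * q ^ 3) := by
      field_simp
      ring
    rw [← sub_nonneg, e]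
    positivity
  rw [rankMean_add, rankMean_const_mul, rankMean_const_mul, h1, h1', rankMean_one_sub] at h2
  refine le_of_eq_of_le ?_ h2
  rw [pow_succ, pow_add, pow_add]
  field_simp
  ring

end

/-! ### The lower inequalities -/

section

variable {q : ℝ} {n T i j r : ℕ}

theorem le_logb_ratio (hq : 1 < q) (hr : r < i) (hi : i ≤ T) :
    (T : ℝ) - i ≤ Real.logb q ((q ^ T - q ^ r) / (q ^ i - q ^ r)) := by
  have hq0 : 0 < q := by linarith
  have h1 : 0 < q ^ i - q ^ r := sub_pos.2 (pow_lt_pow_right₀ hq hr)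
  obtain ⟨K, rfl⟩ := Nat.exists_eq_add_of_le hi
  have h2 : q ^ K ≤ (q ^ (i + K) - q ^ r) / (q ^ i - q ^ r) := by
    rw [le_div_iff₀ h1, pow_add]
    nlinarith [one_le_pow₀ (n := K) hq.le, pow_pos hq0 r]
  have h3 := Real.logb_le_logb_of_le hq (by positivity) h2
  rw [Real.logb_pow, Real.logb_self_eq_one hq] at h3
  push_cast
  linarith

theorem logb_ratio_le (hq : 1 < q) (hr : r < i) (hi : i ≤ T) :
    Real.logb q ((q ^ T - q ^ r) / (q ^ i - q ^ r)) ≤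
      (T : ℝ) - i - Real.logb q (1 - q ^ r / q ^ i) := by
  have h1 : 0 < q ^ i - q ^ r := sub_pos.2 (pow_lt_pow_right₀ hq hr)
  have h0 : 0 < 1 - q ^ r / q ^ i := by
    rw [sub_pos, div_lt_one (by positivity)]
    linarith
  obtain ⟨K, rfl⟩ := Nat.exists_eq_add_of_le hi
  have h2 : (q ^ (i + K) - q ^ r) / (q ^ i - q ^ r) ≤ q ^ K / (1 - q ^ r / q ^ i) := by
    rw [div_le_div_iff₀ h1 h0, pow_add]
    have e : q ^ K * (q ^ i - q ^ r) = (q ^ i * q ^ K) * (1 - q ^ r / q ^ i) := by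
      field_simp
    rw [e]
    have : 0 < q ^ r := by positivity
    exact mul_le_mul_of_nonneg_right (by linarith) h0.le
  have h4 : 0 < (q ^ (i + K) - q ^ r) / (q ^ i - q ^ r) :=
    div_pos (sub_pos.2 (pow_lt_pow_right₀ hq (by omega))) h1
  have h3 := Real.logb_le_logb_of_le hq h4 h2
  rw [Real.logb_div (by positivity) h0.ne', Real.logb_pow, Real.logb_self_eq_one hq] at h3
  push_cast
  linarith

/-- A bound for the ranks below `n` suffices, since at rank `n` nothing is gained. -/
theorem rankMean_le_rankGain (hq : 1 < q) {f : ℕ → ℝ} (hn : n ≤ j → f n ≤ 0)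
    (h : ∀ r, r < n → r ≤ j →
      f r ≤ (1 - q ^ r / q ^ n) * Real.logb q ((q ^ T - q ^ r) / (q ^ i - q ^ r))) :
    rankMean q n j f ≤ rankGain q q n T i j := by
  refine rankMean_mono hq.le fun r hr hrj => ?_
  rcases hr.eq_or_lt with rfl | hr
  · rw [div_self (by positivity), sub_self, zero_mul]
    exact hn hrj
  · exact h r hr hrj

theorem rankGain_le_rankMean (hq : 1 < q) {f : ℕ → ℝ} (hn : n ≤ j → 0 ≤ f n)
    (h : ∀ r, r < n → r ≤ j →
      (1 - q ^ r / q ^ n) * Real.logb q ((q ^ T - q ^ r) / (q ^ i - q ^ r)) ≤ f r) :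
    rankGain q q n T i j ≤ rankMean q n j f := by
  refine rankMean_mono hq.le fun r hr hrj => ?_
  rcases hr.eq_or_lt with rfl | hr
  · rw [div_self (by positivity), sub_self, zero_mul]
    exact hn hrj
  · exact h r hr hrj

theorem one_sub_pow_div_nonneg (hq : 1 < q) (hr : r ≤ n) : 0 ≤ 1 - q ^ r / q ^ n :=
  sub_nonneg.2 (div_le_one_of_le₀ (pow_le_pow_right₀ hq.le hr) (by positivity))

theorem mul_one_sub_stallProb_le_rankGain (hq : 1 < q) {g : ℝ}
    (h : ∀ r, r < n → r ≤ j → g ≤ Real.logb q ((q ^ T - q ^ r) / (q ^ i - q ^ r))) :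
    g * (1 - stallProb q n j) ≤ rankGain q q n T i j := by
  rw [← rankMean_one_sub, ← rankMean_const_mul]
  refine rankMean_le_rankGain hq (fun _ => ?_) fun r hr hrj => ?_
  · rw [div_self (by positivity), sub_self, mul_zero]
  · rw [mul_comm]
    exact mul_le_mul_of_nonneg_left (h r hr hrj) (one_sub_pow_div_nonneg hq hr.le)

theorem rankGain_le_mul_one_sub_stallProb (hq : 1 < q) {g : ℝ}
    (h : ∀ r, r < n → r ≤ j → Real.logb q ((q ^ T - q ^ r) / (q ^ i - q ^ r)) ≤ g) :
    rankGain q q n T i j ≤ g * (1 - stallProb q n j) := by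
  rw [← rankMean_one_sub, ← rankMean_const_mul]
  refine rankGain_le_rankMean hq (fun _ => ?_) fun r hr hrj => ?_
  · rw [div_self (by positivity), sub_self, mul_zero]
  · rw [mul_comm g]
    exact mul_le_mul_of_nonneg_left (h r hr hrj) (one_sub_pow_div_nonneg hq hr.le)

theorem neg_logb_one_sub_mono (hq : 1 < q) {a b : ℝ} (hab : a ≤ b) (hb : b < 1) :
    -Real.logb q (1 - a) ≤ -Real.logb q (1 - b) :=
  neg_le_neg (Real.logb_le_logb_of_le hq (by linarith) (by linarith))

theorem pow_div_pow_le_one_div (hq : 1 < q) {p : ℕ} (h : r + p ≤ i) :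
    q ^ r / q ^ i ≤ 1 / q ^ p := by
  rw [div_le_div_iff₀ (by positivity) (by positivity), ← pow_add, one_mul]
  exact pow_le_pow_right₀ hq.le h

theorem logb_ratio_le_of_add_le (hq : 1 < q) {p : ℕ} (hp : 1 ≤ p) (hr : r + p ≤ i) (hi : i ≤ T) :
    Real.logb q ((q ^ T - q ^ r) / (q ^ i - q ^ r)) ≤
      (T : ℝ) - i - Real.logb q (1 - 1 / q ^ p) := by
  have h1 := logb_ratio_le hq (show r < i by omega) hi
  have h2 := neg_logb_one_sub_mono hq (pow_div_pow_le_one_div hq hr)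
    (by rw [div_lt_one (by positivity)]; exact one_lt_pow₀ hq (by omega))
  linarith

/-- When a new column stalls with probability at most `1 / (n + 1)`, it is worth its cost. -/
theorem le_rankGain_of_le_pow (hq : 1 < q) (hi : i ≤ n) (hT : n + i < T) (hji : j < i)
    (h : (n : ℝ) + 1 ≤ q ^ (n - i + 1)) : (n : ℝ) ≤ rankGain q q n T i j := by
  have hK : (n : ℝ) + 1 ≤ (T : ℝ) - i := by
    have : (n : ℝ) + i + 1 ≤ T := by exact_mod_cast hT
    linarith
  refine le_trans ?_ (mul_one_sub_stallProb_le_rankGain hq fun r _ hrj =>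
    le_logb_ratio hq (show r < i by omega) (by omega))
  have h1 : stallProb q n j ≤ 1 / (n + 1) :=
    (stallProb_le hq.le (by omega)).trans (one_div_le_one_div_of_le (by positivity)
      (h.trans (pow_le_pow_right₀ hq.le (by omega))))
  have h2 : (n : ℝ) = (n + 1) * (1 - 1 / (n + 1)) := by field_simp; ring
  have h3 : (0 : ℝ) ≤ 1 - 1 / (n + 1) := by
    rw [sub_nonneg, div_le_one (by positivity)]
    linarith [Nat.cast_nonneg (α := ℝ) n]
  calc (n : ℝ) = (n + 1) * (1 - 1 / (n + 1)) := h2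
    _ ≤ _ := mul_le_mul hK (by linarith) h3 (by linarith [Nat.cast_nonneg (α := ℝ) n])

end

theorem neg_log_one_sub_le {z : ℝ} (hz : z < 1) : -Real.log (1 - z) ≤ z / (1 - z) := by
  have h := Real.one_sub_inv_le_log_of_pos (show 0 < 1 - z by linarith)
  have e : z / (1 - z) = (1 - z)⁻¹ - 1 := by
    have : 1 - z ≠ 0 := by linarith
    field_simp
    ring
  linarith

theorem neg_logb_one_sub_le_of_three_le {q z : ℝ} (hq : 3 ≤ q) (hz0 : 0 ≤ z) (hz : z ≤ 1 / 3) :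
    -Real.logb q (1 - z) ≤ 3 / 2 * z := by
  have h1 := neg_log_one_sub_le (show z < 1 by linarith)
  have h2 : z / (1 - z) ≤ 3 / 2 * z := by
    rw [div_le_iff₀ (by linarith)]
    nlinarith
  have h3 : 1 ≤ Real.log q := by
    have := Real.log_le_log (by norm_num) hq
    linarith [Real.log_three_gt_d9]
  rw [Real.logb, ← neg_div, div_le_iff₀ (by linarith)]
  nlinarith

theorem neg_logb_two_one_sub_le (p : ℕ) (hp : 1 ≤ p) :
    -Real.logb 2 (1 - 1 / 2 ^ p) ≤ 2 * (1 / 2 ^ p) := by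
  obtain rfl | hp := hp.eq_or_lt
  · rw [show (1 : ℝ) - 1 / 2 ^ 1 = 2⁻¹ by norm_num, Real.logb_inv, Real.logb_self_eq_one one_lt_two]
    norm_num
  · have hz : (1 : ℝ) / 2 ^ p ≤ 1 / 4 := by
      have := pow_le_pow_right₀ (one_le_two (α := ℝ)) (show 2 ≤ p from hp)
      exact one_div_le_one_div_of_le (by norm_num) (by linarith)
    have hz0 : (0 : ℝ) ≤ 1 / 2 ^ p := by positivity
    have h1 := neg_log_one_sub_le (show (1 : ℝ) / 2 ^ p < 1 by linarith)
    set z : ℝ := 1 / 2 ^ p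
    have h2 : z / (1 - z) ≤ 4 / 3 * z := by
      rw [div_le_iff₀ (by linarith)]
      nlinarith
    rw [Real.logb, ← neg_div, div_le_iff₀ (by linarith [Real.log_two_gt_d9])]
    nlinarith [Real.log_two_gt_d9]

/-- `4 / 3 ≤ 2 ^ (31 / 72)`. -/
theorem neg_logb_two_three_quarters_le : -Real.logb 2 (1 - 1 / 2 ^ 2) ≤ 31 / 72 := by
  rw [← Real.logb_inv, Real.logb_le_iff_le_rpow one_lt_two (by norm_num)]
  have h : (((1 - 1 / 2 ^ 2)⁻¹ : ℝ)) ^ 72 ≤ ((2 : ℝ) ^ (31 / 72 : ℝ)) ^ 72 := by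
    rw [← Real.rpow_natCast ((2 : ℝ) ^ (31 / 72 : ℝ)), ← Real.rpow_mul (by norm_num),
      show (31 / 72 : ℝ) * (72 : ℕ) = (31 : ℕ) by norm_num, Real.rpow_natCast]
    norm_num
  exact le_of_pow_le_pow_left₀ (by norm_num) (by positivity) h

theorem neg_logb_two_one_sub_le_of_three_le (p : ℕ) (hp : 3 ≤ p) :
    -Real.logb 2 (1 - 1 / 2 ^ p) ≤ 7 / 4 * (1 / 2 ^ p) := by
  have hz : (1 : ℝ) / 2 ^ p ≤ 1 / 8 := by
    have := pow_le_pow_right₀ (one_le_two (α := ℝ)) hp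
    exact one_div_le_one_div_of_le (by norm_num) (by linarith)
  have hz0 : (0 : ℝ) ≤ 1 / 2 ^ p := by positivity
  have h1 := neg_log_one_sub_le (show (1 : ℝ) / 2 ^ p < 1 by linarith)
  set z : ℝ := 1 / 2 ^ p
  have h2 : z / (1 - z) ≤ 8 / 7 * z := by
    rw [div_le_iff₀ (by linarith)]
    nlinarith
  rw [Real.logb, ← neg_div, div_le_iff₀ (by linarith [Real.log_two_gt_d9])]
  nlinarith [Real.log_two_gt_d9]

/-- When the field size passes from `q` to `q + 1`, the decrease of the stalling probability, times
`K = T - i`, outweighs the logarithmic correction at `q`. The exponents stand for `s = n - j`,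
`σ = n - i + 1` and `p = i - j`. For `q = 2` and `s = 2` the margin is a few per cent. -/
theorem neg_logb_le_mul_sub {q σ p s : ℕ} (hq : 2 ≤ q) (hσ : 1 ≤ σ) (hp : 1 ≤ p)
    (hs : s + 1 = σ + p) (hs2 : 2 ≤ s) {K : ℝ} (hK : ((q : ℝ) + 1) ^ σ + 1 ≤ K) :
    -Real.logb q (1 - 1 / (q : ℝ) ^ p) ≤
      K * (1 / (q : ℝ) ^ s - 1 / (q : ℝ) ^ (2 * s + 1) - 1 / ((q : ℝ) + 1) ^ s) := by
  have hqr : (2 : ℝ) ≤ q := by exact_mod_cast hq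
  have hq0 : (0 : ℝ) < q := by linarith
  have hD : 1 / (q : ℝ) ^ s - 1 / (q : ℝ) ^ (2 * s + 1) - 1 / ((q : ℝ) + 1) ^ s =
      1 / (q : ℝ) ^ s * (1 - 1 / (q : ℝ) ^ (s + 1) - ((q : ℝ) / (q + 1)) ^ s) := by
    rw [div_pow, two_mul, add_assoc, pow_add]
    field_simp
  have hqs : ((q : ℝ) + 1) ^ σ * (1 / (q : ℝ) ^ s) =
      (((q : ℝ) + 1) / q) ^ σ * (q * (1 / (q : ℝ) ^ p)) := by
    have : (q : ℝ) ^ s * q = (q : ℝ) ^ σ * (q : ℝ) ^ p := by rw [← pow_succ, hs, pow_add]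
    rw [div_pow]
    field_simp
    linarith
  have hpow : 0 < 1 / (q : ℝ) ^ s := by positivity
  have hpowp : 0 < 1 / (q : ℝ) ^ p := by positivity
  have hrat : ((q : ℝ) / (q + 1)) ^ s ≤ ((q : ℝ) / (q + 1)) ^ 2 :=
    pow_le_pow_of_le_one (by positivity) (by rw [div_le_one (by positivity)]; linarith) hs2
  have hrat1 : 1 ≤ ((q : ℝ) + 1) / q := by rw [le_div_iff₀ hq0]; linarith
  rcases hq.eq_or_lt with h2 | h3
  · subst h2
    push_cast at *
    rcases hs2.eq_or_lt with h2 | h3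
    · subst h2
      have hcases : (σ = 1 ∧ p = 2) ∨ (σ = 2 ∧ p = 1) := by omega
      rcases hcases with ⟨rfl, rfl⟩ | ⟨rfl, rfl⟩
      · have := neg_logb_two_three_quarters_le
        norm_num at this hK ⊢
        linarith
      · have := neg_logb_two_one_sub_le 1 le_rfl
        norm_num at this hK ⊢
        linarith
    · have hd : (1 : ℝ) - 1 / 16 - 8 / 27 ≤ 1 - 1 / 2 ^ (s + 1) - (2 / (2 + 1)) ^ s := by
        have e1 : (1 : ℝ) / 2 ^ (s + 1) ≤ 1 / 2 ^ 4 := one_div_le_one_div_of_le (by norm_num)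
          (pow_le_pow_right₀ one_le_two (by omega))
        have e2 : ((2 : ℝ) / (2 + 1)) ^ s ≤ (2 / (2 + 1)) ^ 3 :=
          pow_le_pow_of_le_one (by norm_num) (by norm_num) h3
        norm_num at e1 e2 ⊢
        linarith
      rw [hD]
      rcases hσ.eq_or_lt with h1 | h1
      · subst h1
        have hsp : s = p := by omega
        subst hsp
        refine (neg_logb_two_one_sub_le_of_three_le s h3).trans ?_
        have hK4 : (4 : ℝ) ≤ K := by norm_num at hK; linarith
        calc 7 / 4 * (1 / (2 : ℝ) ^ s) ≤ 4 * (1 / 2 ^ s * (1 - 1 / 16 - 8 / 27)) := by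
              nlinarith
          _ ≤ _ := mul_le_mul hK4 (mul_le_mul_of_nonneg_left hd hpow.le) (by positivity)
            (by linarith)
      · refine (neg_logb_two_one_sub_le p hp).trans ?_
        have hK' : ((2 : ℝ) + 1) ^ σ ≤ K := by linarith
        have h94 : ((3 : ℝ) / 2) ^ 2 ≤ ((2 + 1) / 2) ^ σ := by
          rw [show ((2 : ℝ) + 1) / 2 = 3 / 2 by norm_num]
          exact pow_le_pow_right₀ (by norm_num) h1
        calc 2 * (1 / (2 : ℝ) ^ p) ≤ (3 / 2) ^ 2 * (2 * (1 / (2 : ℝ) ^ p)) * (1 - 1 / 16 - 8 / 27) := by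
              nlinarith
          _ ≤ (((2 : ℝ) + 1) / 2) ^ σ * (2 * (1 / (2 : ℝ) ^ p)) * (1 - 1 / 16 - 8 / 27) := by
              gcongr
          _ = ((2 : ℝ) + 1) ^ σ * (1 / 2 ^ s * (1 - 1 / 16 - 8 / 27)) := by rw [← hqs]; ring
          _ ≤ _ := mul_le_mul hK' (mul_le_mul_of_nonneg_left hd hpow.le) (by positivity)
            ((by positivity : (0 : ℝ) ≤ (2 + 1) ^ σ).trans hK')
  · have hqr3 : (3 : ℝ) ≤ q := by exact_mod_cast h3
    have hz : 1 / (q : ℝ) ^ p ≤ 1 / 3 :=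
      one_div_le_one_div_of_le (by norm_num) (hqr3.trans (le_self_pow₀ (by linarith) (by omega)))
    refine (neg_logb_one_sub_le_of_three_le hqr3 hpowp.le hz).trans ?_
    have hd : 3 / 2 ≤ ((q : ℝ) + 1) *
        (1 - 1 / (q : ℝ) ^ (s + 1) - ((q : ℝ) / (q + 1)) ^ s) := by
      have e1 : 1 / (q : ℝ) ^ (s + 1) ≤ 1 / (q : ℝ) ^ 3 :=
        one_div_le_one_div_of_le (by positivity) (pow_le_pow_right₀ (by linarith) (by omega))
      have e2 : 3 / 2 ≤ ((q : ℝ) + 1) * (1 - 1 / (q : ℝ) ^ 3 - ((q : ℝ) / (q + 1)) ^ 2) := by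
        have e3 : ((q : ℝ) + 1) * (1 - 1 / (q : ℝ) ^ 3 - ((q : ℝ) / (q + 1)) ^ 2) - 3 / 2 =
          ((q ^ 3 * (q + 1) - 2 * (q + 1) ^ 2 - 2 * q ^ 3) : ℝ) / (2 * q ^ 3 * (q + 1)) := by
          field_simp
          ring
        rw [← sub_nonneg, e3]
        apply div_nonneg _ (by positivity)
        nlinarith [mul_nonneg (sub_nonneg.2 hqr3) (sq_nonneg ((q : ℝ) - 3)),
          mul_nonneg (mul_nonneg (sub_nonneg.2 hqr3) (sub_nonneg.2 hqr3))
            (sq_nonneg (q : ℝ)), pow_pos hq0 3]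
      refine e2.trans (mul_le_mul_of_nonneg_left (by linarith) (by positivity))
    have hd0 : 0 ≤ 1 - 1 / (q : ℝ) ^ (s + 1) - ((q : ℝ) / (q + 1)) ^ s :=
      le_of_lt (pos_of_mul_pos_right (lt_of_lt_of_le (by norm_num) hd) (by positivity))
    rw [hD]
    have hK' : ((q : ℝ) + 1) ^ σ ≤ K := by linarith
    have hσ' : ((q : ℝ) + 1) / q ≤ (((q : ℝ) + 1) / q) ^ σ := le_self_pow₀ hrat1 (by omega)
    set d := 1 - 1 / (q : ℝ) ^ (s + 1) - ((q : ℝ) / (q + 1)) ^ s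
    calc 3 / 2 * (1 / (q : ℝ) ^ p) ≤ ((q : ℝ) + 1) * d * (1 / (q : ℝ) ^ p) :=
          mul_le_mul_of_nonneg_right hd hpowp.le
      _ = ((q : ℝ) + 1) / q * (q * (1 / (q : ℝ) ^ p)) * d := by field_simp
      _ ≤ (((q : ℝ) + 1) / q) ^ σ * (q * (1 / (q : ℝ) ^ p)) * d := by gcongr
      _ = ((q : ℝ) + 1) ^ σ * (1 / (q : ℝ) ^ s * d) := by rw [← hqs]; ring
      _ ≤ _ := mul_le_mul_of_nonneg_right hK' (mul_nonneg hpow.le hd0)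

/-- The case in which stalling has probability of order `q ^ (-2)` or less: the trivial bound for
the larger field is enough. -/
theorem rankGain_le_succ_of_two_le {q n T i j : ℕ} (hq : 2 ≤ q) (hi : i ≤ n) (hT : n + i < T)
    (hji : j < i) (hs : 2 ≤ n - j) (h : (q + 1) ^ (n - i + 1) < n + 1) :
    rankGain q q n T i j ≤ rankGain ((q : ℝ) + 1) ((q : ℝ) + 1) n T i j := by
  have hqr : (2 : ℝ) ≤ q := by exact_mod_cast hq
  -- `T - i ≥ n + 1`, and `n` is at least `(q + 1) ^ (n - i + 1)`
  have hK : ((q : ℝ) + 1) ^ (n - i + 1) + 1 ≤ (T : ℝ) - i := by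
    have h1 : (q + 1) ^ (n - i + 1) + 1 + i ≤ T := by omega
    have h2 : ((q : ℝ) + 1) ^ (n - i + 1) + 1 + i ≤ T := by exact_mod_cast h1
    linarith
  have hK0 : 0 ≤ (T : ℝ) - i := le_trans (by positivity) hK
  have h1 := rankGain_le_mul_one_sub_stallProb (q := q) (n := n) (T := T) (i := i) (j := j)
    (by linarith) fun r _ hrj => logb_ratio_le_of_add_le (by linarith) (show 1 ≤ i - j by omega)
      (show r + (i - j) ≤ i by omega) (by omega)
  have h2 := mul_one_sub_stallProb_le_rankGain (q := (q : ℝ) + 1) (n := n) (T := T) (i := i)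
    (j := j) (by linarith) fun r _ hrj => le_logb_ratio (by linarith) (show r < i by omega)
      (by omega)
  have h3 := neg_logb_le_mul_sub hq (show 1 ≤ n - i + 1 by omega) (show 1 ≤ i - j by omega)
    (show (n - j) + 1 = _ by omega) hs hK
  have ha := le_stallProb (q := q) (by linarith) (show j ≤ n by omega)
  have ha' := stallProb_le (q := (q : ℝ) + 1) (by linarith) (show j ≤ n by omega)
  have ha0 := stallProb_nonneg (q := q) (by linarith) n j
  set c := -Real.logb q (1 - 1 / (q : ℝ) ^ (i - j)) with hc
  have hc0 : 0 ≤ c := by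
    rw [hc, ← neg_zero, neg_le_neg_iff]
    refine Real.logb_nonpos (by linarith) ?_ ?_
    · rw [sub_nonneg, div_le_one (by positivity)]
      exact one_le_pow₀ (by linarith)
    · rw [sub_le_self_iff]
      positivity
  have h4 : 1 / (q : ℝ) ^ (2 * (n - j) + 1) * (1 - 1 / (q : ℝ) ^ j) ≤
      1 / (q : ℝ) ^ (2 * (n - j) + 1) :=
    mul_le_of_le_one_right (by positivity) (by rw [sub_le_self_iff]; positivity)
  rw [sub_eq_add_neg, ← hc] at h1
  nlinarith [mul_nonneg hc0 ha0]

/-- The logarithmic correction is controlled by the stalling probability. -/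
theorem rankGain_self_le {q : ℝ} {n T j : ℕ} (hq : 1 < q) (hT : n ≤ T) :
    rankGain q q n T n j ≤
      ((T : ℝ) - n) * (1 - stallProb q n j) + 1 / Real.log q * stallProb q n j := by
  have hl : 0 < Real.log q := Real.log_pos hq
  rw [← rankMean_one_sub, stallProb, ← rankMean_const_mul, ← rankMean_const_mul, ← rankMean_add]
  refine rankGain_le_rankMean hq (fun _ => ?_) fun r hr _ => ?_
  · rw [div_self (by positivity), sub_self, mul_zero]
    positivity
  · set y := q ^ r / q ^ n with hy
    have hy1 : y < 1 := by
      rw [hy, div_lt_one (by positivity)]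
      exact pow_lt_pow_right₀ hq hr
    have h1 := mul_le_mul_of_nonneg_left (logb_ratio_le hq hr hT) (sub_nonneg.2 hy1.le)
    rw [← hy] at h1
    have h2 := neg_log_one_sub_le hy1
    rw [le_div_iff₀ (by linarith)] at h2
    have h3 : (1 - y) * -Real.logb q (1 - y) ≤ 1 / Real.log q * y := by
      rw [Real.logb, ← neg_div, ← mul_div_assoc, div_le_iff₀ hl]
      have : 1 / Real.log q * y * Real.log q = y := by field_simp
      linarith
    linarith

/-- The case of stalling probability about `1 / q`. Here the bound for the larger field needs its
term of third order. -/
theorem rankGain_le_succ_of_three_le {q n T j : ℕ} (hq : 3 ≤ q) (hT : n + n < T) (hj : j + 1 = n)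
    (h : q + 1 < n + 1) :
    rankGain q q n T n j ≤ rankGain ((q : ℝ) + 1) ((q : ℝ) + 1) n T n j := by
  subst hj
  have hqr : (3 : ℝ) ≤ q := by exact_mod_cast hq
  have hK : (q : ℝ) + 2 ≤ (T : ℝ) - (j + 1 : ℕ) := by
    have h1 : q + 2 + (j + 1) ≤ T := by omega
    have h2 : (q : ℝ) + 2 + (j + 1 : ℕ) ≤ T := by exact_mod_cast h1
    linarith
  have h1 := rankGain_self_le (q := q) (j := j) (by linarith) (show j + 1 ≤ T by omega)
  have h2 := mul_one_sub_stallProb_le_rankGain (q := (q : ℝ) + 1) (n := j + 1) (T := T)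
    (i := j + 1) (j := j) (by linarith) fun r hr _ => le_logb_ratio (by linarith) hr (by omega)
  have ha := le_stallProb (q := q) (by linarith) (show j ≤ j + 1 by omega)
  have ha' := stallProb_pred_le (q := (q : ℝ) + 1) (by linarith) j
  rw [Nat.add_sub_cancel_left] at ha
  -- `1 / log 3 < 0.911`
  have hl : 1 / Real.log q ≤ 0.911 := by
    have h3 := Real.log_le_log (by norm_num) hqr
    have h4 := Real.log_three_gt_d9
    rw [div_le_iff₀ (by linarith)]
    linarith
  set K := (T : ℝ) - (j + 1 : ℕ)
  set Q := (q : ℝ) + 1 with hQ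
  have hQ4 : 4 ≤ Q := by linarith
  have hpj : Q ^ 2 ≤ Q ^ j := pow_le_pow_right₀ (by linarith) (by omega)
  have hx2 : 1 / Q ^ j ≤ 1 / Q ^ 2 := one_div_le_one_div_of_le (by positivity) hpj
  have hx0 : 0 < 1 / Q ^ j := by positivity
  have hx16 : 1 / Q ^ 2 ≤ 1 / 16 := one_div_le_one_div_of_le (by norm_num) (by nlinarith)
  -- `59 / 64 = 1 - 1 / 16 - 1 / 64` collects the corrections of second and third order
  have hup : stallProb Q (j + 1) j ≤ 1 / Q - 59 / 64 * (1 / Q ^ 3) := by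
    have e1 : 1 / Q ^ 6 * (1 - 1 / Q ^ j) * (1 - Q / Q ^ j) ≤ 1 / Q ^ 6 := by
      have : Q / Q ^ j ≤ 1 := by
        rw [div_le_one (by positivity)]
        exact le_self_pow₀ (by linarith) (by omega)
      have h0 : 0 < Q / Q ^ j := by positivity
      rw [mul_assoc]
      refine mul_le_of_le_one_right (by positivity) ?_
      nlinarith
    have e2 : 1 / Q ^ 6 ≤ 1 / 64 * (1 / Q ^ 3) := by
      rw [show 1 / Q ^ 6 = 1 / Q ^ 3 * (1 / Q ^ 3) by field_simp]
      refine mul_le_mul_of_nonneg_right ?_ (by positivity)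
      refine one_div_le_one_div_of_le (by norm_num) ?_
      have := pow_le_pow_left₀ (by norm_num) hQ4 3
      linarith
    have e3 : 1 / Q ^ 3 * (15 / 16) ≤ 1 / Q ^ 3 * (1 - 1 / Q ^ j) :=
      mul_le_mul_of_nonneg_left (by linarith) (by positivity)
    linarith
  have hlow : 1 / (q : ℝ) - 1 / (q : ℝ) ^ 3 ≤ stallProb q (j + 1) j := by
    have : 1 / (q : ℝ) ^ (2 * 1 + 1) * (1 - 1 / (q : ℝ) ^ j) ≤ 1 / (q : ℝ) ^ (2 * 1 + 1) :=
      mul_le_of_le_one_right (by positivity) (by rw [sub_le_self_iff]; positivity)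
    norm_num at this ha ⊢
    linarith
  have key : ((q : ℝ) + 2) * (1 / Q - 59 / 64 * (1 / Q ^ 3)) ≤
      (1 / (q : ℝ) - 1 / (q : ℝ) ^ 3) * ((q : ℝ) + 2 - 0.911) := by
    rw [hQ, ← sub_nonneg]
    obtain ⟨t, ht⟩ : ∃ t, t = (q : ℝ) - 3 := ⟨_, rfl⟩
    have ht0 : 0 ≤ t := by linarith
    have e : (1 / (q : ℝ) - 1 / (q : ℝ) ^ 3) * ((q : ℝ) + 2 - 0.911) -
        ((q : ℝ) + 2) * (1 / ((q : ℝ) + 1) - 59 / 64 * (1 / ((q : ℝ) + 1) ^ 3)) =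
        (464169 / 8000 + 518783 / 4000 * t + 83247 / 1000 * t ^ 2 + 89193 / 4000 * t ^ 3 + 20191 / 8000 * t ^ 4 + 89 / 1000 * t ^ 5) / ((q : ℝ) ^ 3 * (q + 1) ^ 3) := by
      rw [show (q : ℝ) = t + 3 by linarith]
      field_simp
      ring
    rw [e]
    positivity
  have key2 : 1 / Q - 59 / 64 * (1 / Q ^ 3) ≤ 1 / (q : ℝ) - 1 / (q : ℝ) ^ 3 := by
    rw [hQ, ← sub_nonneg]
    obtain ⟨t, ht⟩ : ∃ t, t = (q : ℝ) - 3 := ⟨_, rfl⟩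
    have ht0 : 0 ≤ t := by linarith
    have e : 1 / (q : ℝ) - 1 / (q : ℝ) ^ 3 -
        (1 / ((q : ℝ) + 1) - 59 / 64 * (1 / ((q : ℝ) + 1) ^ 3)) =
        (6713 / 64 + 9273 / 64 * t + 4435 / 64 * t ^ 2 + 891 / 64 * t ^ 3 + 1 * t ^ 4) / ((q : ℝ) ^ 3 * (q + 1) ^ 3) := by
      rw [show (q : ℝ) = t + 3 by linarith]
      field_simp
      ring
    rw [e]
    positivity
  have ha0 := stallProb_nonneg (q := q) (by linarith) (j + 1) j
  set a := stallProb q (j + 1) j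
  set a' := stallProb Q (j + 1) j
  have h5 : K * a' ≤ a * (K - 0.911) := by
    have e1 : K * a' ≤ K * (1 / Q - 59 / 64 * (1 / Q ^ 3)) :=
      mul_le_mul_of_nonneg_left hup (by linarith)
    have e2 : (1 / (q : ℝ) - 1 / (q : ℝ) ^ 3) * (K - 0.911) ≤ a * (K - 0.911) :=
      mul_le_mul_of_nonneg_right hlow (by norm_num at hK ⊢; linarith)
    have e3 := mul_le_mul_of_nonneg_left key2 (sub_nonneg.2 hK)
    linarith
  have h6 := mul_le_mul_of_nonneg_right hl ha0
  linarith

/-- For `q = 2` the logarithmic correction for the larger field is needed as well, through its main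
part, the part of rank `j = n - 1`. -/
theorem rankGain_two_le_three {n T j : ℕ} (hT : n + n < T) (hj : j + 1 = n) (h : 3 ≤ n) :
    rankGain 2 2 n T n j ≤ rankGain 3 3 n T n j := by
  subst hj
  have h1 := rankGain_self_le (q := 2) (j := j) one_lt_two (show j + 1 ≤ T by omega)
  have ha := le_stallProb (q := 2) (by norm_num) (show j ≤ j + 1 by omega)
  have hb := le_stallProb (q := 3) (by norm_num) (show j ≤ j + 1 by omega)
  have ha' := stallProb_pred_le (q := 3) (by norm_num) j
  rw [Nat.add_sub_cancel_left] at ha hb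
  have hTr : ((j + 1 : ℕ) : ℝ) + (j + 1 : ℕ) + 1 ≤ T := by exact_mod_cast hT
  set K := (T : ℝ) - (j + 1 : ℕ) with hK
  have hK4 : (j : ℝ) + 2 ≤ K := by
    push_cast at hTr hK
    linarith
  -- the correction of the rank `j`, where the new column stalls with probability `1 / 3`
  have h2 : K * (1 - stallProb 3 (j + 1) j) + (stallProb 3 (j + 1) j - 1 / 9) ≤
      rankGain 3 3 (j + 1) T (j + 1) j := by
    have e : K * (1 - stallProb 3 (j + 1) j) + (stallProb 3 (j + 1) j - 1 / 9) =
        rankMean 3 (j + 1) j fun r => (K - 1 / 9) + (1 - K) * (3 ^ r / 3 ^ (j + 1)) := by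
      rw [rankMean_add, rankMean_const, rankMean_const_mul, ← stallProb]
      ring
    rw [e]
    refine rankMean_le_rankGain (by norm_num) (fun hj => by omega) fun r hr hrj => ?_
    · have h0 := one_sub_pow_div_nonneg (q := 3) (by norm_num) hr.le
      rcases hrj.eq_or_lt with rfl | hrj
      · have hy : (3 : ℝ) ^ r / 3 ^ (r + 1) = 1 / 3 := by
          rw [pow_succ]
          field_simp
        rw [hy]
        have hc : K + 1 / 3 ≤ Real.logb 3 ((3 ^ T - 3 ^ r) / (3 ^ (r + 1) - 3 ^ r)) := by
          have hT4 : r + 1 + 3 ≤ T := by omega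
          obtain ⟨k, rfl⟩ := Nat.exists_eq_add_of_le hT4
          have hKk : K = (k + 3 : ℕ) := by
            rw [hK]
            push_cast
            ring
          have hd : (3 : ℝ) ^ (r + 1) - 3 ^ r = 2 * 3 ^ r := by ring
          have h3k : (1 : ℝ) ≤ 3 ^ k := one_le_pow₀ (by norm_num)
          -- `1.45 ^ 3 > 3`
          have h145 : (3 : ℝ) ^ (1 / 3 : ℝ) ≤ 1.45 := by
            refine le_of_pow_le_pow_left₀ (n := 3) (by norm_num) (by norm_num) ?_
            rw [← Real.rpow_natCast, ← Real.rpow_mul (by norm_num)]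
            norm_num
          rw [hd, Real.le_logb_iff_rpow_le (by norm_num) (div_pos (sub_pos.2
            (pow_lt_pow_right₀ (by norm_num) (by omega))) (by positivity)),
            Real.rpow_add (by norm_num), hKk, Real.rpow_natCast, le_div_iff₀ (by positivity)]
          have e : (3 : ℝ) ^ (r + 1 + 3 + k) = 3 ^ r * (81 * 3 ^ k) := by ring
          have e' : (3 : ℝ) ^ (k + 3) = 27 * 3 ^ k := by ring
          rw [e, e']
          have hr0 : (0 : ℝ) < 3 ^ r := by positivity
          have h4 := mul_le_mul_of_nonneg_left h145 (show (0 : ℝ) ≤ 27 * 3 ^ k by positivity)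
          calc _ ≤ (27 * 3 ^ k * 1.45) * (2 * (3 : ℝ) ^ r) :=
                mul_le_mul_of_nonneg_right h4 (by positivity)
            _ = 3 ^ r * (78.3 * 3 ^ k) := by ring
            _ ≤ 3 ^ r * (81 * 3 ^ k - 1) := mul_le_mul_of_nonneg_left (by linarith) hr0.le
            _ = _ := by ring
        linarith
      · have hy : (3 : ℝ) ^ r / 3 ^ (j + 1) ≤ 1 / 3 ^ 2 :=
          pow_div_pow_le_one_div (by norm_num) (by omega)
        have hc := mul_le_mul_of_nonneg_left
          (le_logb_ratio (q := 3) (T := T) (by norm_num) hr (by omega)) h0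
        refine le_trans ?_ hc
        rw [← hK]
        norm_num at hy
        linarith
  have hl : 1 / Real.log 2 ≤ 1.4427 := by
    have := Real.log_two_gt_d9
    rw [div_le_iff₀ (by linarith)]
    linarith
  have ha0 := stallProb_nonneg (q := 2) (by norm_num) (j + 1) j
  have h6 := mul_le_mul_of_nonneg_right hl ha0
  set a := stallProb 2 (j + 1) j
  set a' := stallProb 3 (j + 1) j
  have key : (K - 1) * a' + 1 / 9 ≤ a * (K - 1.4427) := by
    have hz0 : (0 : ℝ) < 1 / 3 ^ j := by positivity
    have hz2 : (0 : ℝ) < 3 / 3 ^ j := by positivity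
    have hw0 : (0 : ℝ) < 1 / 2 ^ j := by positivity
    have e1 : (1 : ℝ) / 3 ^ 6 * (1 - 1 / 3 ^ j) * (1 - 3 / 3 ^ j) ≤ 1 / 3 ^ 6 := by
      rw [mul_assoc]
      refine mul_le_of_le_one_right (by positivity) ?_
      have : (1 : ℝ) / 3 ^ j ≤ 1 := by
        rw [div_le_one (by positivity)]
        exact one_le_pow₀ (by norm_num)
      nlinarith
    rcases (show 2 ≤ j by omega).eq_or_lt with h2 | h3
    · subst h2
      norm_num at ha ha' hK4 ⊢
      nlinarith
    · have hj3 : (3 : ℝ) ≤ j := by exact_mod_cast h3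
      have hw : (1 : ℝ) / 3 ^ j ≤ 1 / 27 := one_div_le_one_div_of_le (by norm_num)
        (by have := pow_le_pow_right₀ (show (1 : ℝ) ≤ 3 by norm_num) h3; norm_num at this; exact this)
      have e2 : a' ≤ 0.2991 := by
        norm_num at ha' e1 ⊢
        norm_num at hw
        linarith
      have e3 : 0.375 ≤ a := by
        norm_num at ha ⊢
        rw [one_div] at hw0
        linarith
      norm_num at e2 e3 ⊢
      nlinarith
  linarith

/-- The lower inequalities get easier when the field size grows. -/
theorem rankGain_le_succ {q n T i j : ℕ} (hq : 2 ≤ q) (hi : i ≤ n) (hT : n + i < T)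
    (hji : j < i) (h : (q + 1) ^ (n - i + 1) < n + 1) :
    rankGain q q n T i j ≤ rankGain ((q : ℝ) + 1) ((q : ℝ) + 1) n T i j := by
  rcases le_or_gt 2 (n - j) with hs | hs
  · exact rankGain_le_succ_of_two_le hq hi hT hji hs h
  · obtain rfl : i = n := by omega
    rw [Nat.sub_self, zero_add, pow_one] at h
    rcases hq.eq_or_lt with rfl | h3
    · have := rankGain_two_le_three hT (show j + 1 = i by omega) (by omega)
      norm_num
      exact this
    · exact rankGain_le_succ_of_three_le h3 hT (by omega) h

/-! ### The upper inequalities -/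

/-- The largest logarithmic correction for the field size `q + 1`. -/
theorem neg_logb_one_sub_inv_succ {q : ℝ} (hq : 0 < q) :
    -Real.logb (q + 1) (1 - 1 / (q + 1) ^ 1) = Real.logb (q + 1) (1 + 1 / q) := by
  rw [← Real.logb_inv]
  congr 1
  rw [pow_one, show 1 - 1 / (q + 1) = q / (q + 1) by field_simp; ring, inv_div, add_div,
    div_self hq.ne']

theorem logb_succ_le {q : ℝ} (hq : 0 < q) :
    Real.logb (q + 1) (1 + 1 / q) ≤ 1 / q / Real.log (q + 1) := by
  have h : Real.log (1 + 1 / q) ≤ 1 / q := by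
    have := Real.log_le_sub_one_of_pos (show 0 < 1 + 1 / q by positivity)
    linarith
  exact div_le_div_of_nonneg_right h (Real.log_nonneg (by linarith))

/-- `(3 / 2) ^ 8 ≤ 3 ^ 3`. -/
theorem logb_three_le : Real.logb (2 + 1) (1 + 1 / 2) ≤ 3 / 8 := by
  rw [Real.logb_le_iff_le_rpow (by norm_num) (by norm_num)]
  refine le_of_pow_le_pow_left₀ (n := 8) (by norm_num) (by positivity) ?_
  rw [← Real.rpow_natCast ((2 + 1 : ℝ) ^ (3 / 8 : ℝ)), ← Real.rpow_mul (by norm_num),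
    show (3 / 8 : ℝ) * (8 : ℕ) = (3 : ℕ) by norm_num, Real.rpow_natCast]
  norm_num

/-- Transfer from field size `q` to `q + 1`, reduced to an inequality without `k`. -/
theorem rankGain_succ_le_of_bound {q n T : ℕ} (k : ℕ) (hq : 2 ≤ q) (hn : 1 ≤ n) (hT : n + n < T)
    {g : ℝ} (hg0 : 0 ≤ g)
    (hg : ∀ r < n, g ≤ Real.logb q (((q : ℝ) ^ T - (q : ℝ) ^ r) / ((q : ℝ) ^ n - (q : ℝ) ^ r)))
    (h : 1 / ((q : ℝ) + 1) * ((1 - 1 / ((q : ℝ) + 1) ^ n) *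
        ((T : ℝ) - n + Real.logb ((q : ℝ) + 1) (1 + 1 / q))) ≤
      1 / (q : ℝ) * (g * ((1 - 1 / (q : ℝ) ^ n) *
        (1 - 1 / (q : ℝ) ^ 2 * (1 - (q : ℝ) / (q : ℝ) ^ n))))) :
    rankGain ((q : ℝ) + 1) ((q : ℝ) + 1) n T n (n + k) ≤ rankGain q q n T n (n + k) := by
  have hqr : (2 : ℝ) ≤ q := by exact_mod_cast hq
  have hTr : (n : ℝ) + n + 1 ≤ T := by exact_mod_cast hT
  have h1 := rankGain_le_mul_one_sub_stallProb (q := (q : ℝ) + 1) (n := n) (T := T) (i := n)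
    (j := n + k) (by linarith) fun r hr _ => logb_ratio_le_of_add_le (by linarith) le_rfl
      (show r + 1 ≤ n by omega) (by omega)
  have h2 := mul_one_sub_stallProb_le_rankGain (q := q) (n := n) (T := T) (i := n)
    (j := n + k) (by linarith) fun r hr _ => hg r hr
  have hu := one_sub_stallProb_le (q := (q : ℝ) + 1) (by linarith) n k
  have hl := le_one_sub_stallProb (q := q) (by linarith) n k
  rw [sub_eq_add_neg, neg_logb_one_sub_inv_succ (by linarith)] at h1
  set L := (T : ℝ) - n + Real.logb ((q : ℝ) + 1) (1 + 1 / q) with hL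
  have hL0 : 0 ≤ L := by
    have : 0 ≤ Real.logb ((q : ℝ) + 1) (1 + 1 / q) :=
      Real.logb_nonneg (by linarith) (by rw [le_add_iff_nonneg_right]; positivity)
    linarith
  have hq1 : (1 : ℝ) / (q : ℝ) ^ n ≤ 1 := by
    rw [div_le_one (by positivity)]
    exact one_le_pow₀ (by linarith)
  have hqn : (q : ℝ) / (q : ℝ) ^ n ≤ 1 := by
    rw [div_le_one (by positivity)]
    exact le_self_pow₀ (by linarith) (by omega)
  have hk : (1 / (q : ℝ)) ^ (k + 2) ≤ (1 / (q : ℝ)) ^ 2 :=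
    pow_le_pow_of_le_one (by positivity) (by rw [div_le_one (by positivity)]; linarith)
      (by omega)
  have hB1 : 0 ≤ 1 - 1 / (q : ℝ) ^ n := by linarith
  have hB : 0 ≤ (1 - 1 / (q : ℝ) ^ n) * (1 - 1 / (q : ℝ) ^ 2 * (1 - (q : ℝ) / (q : ℝ) ^ n)) := by
    have h4 : 1 / (q : ℝ) ^ 2 ≤ 1 := by
      rw [div_le_one (by positivity)]
      exact one_le_pow₀ (by linarith)
    have h5 : 0 < (q : ℝ) / (q : ℝ) ^ n := by positivity
    exact mul_nonneg hB1 (sub_nonneg.2 (mul_le_one₀ h4 (by linarith) (by linarith)))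
  calc _ ≤ L * (1 - stallProb ((q : ℝ) + 1) n (n + k)) := h1
    _ ≤ L * (1 / ((q : ℝ) + 1) ^ (k + 1) * (1 - 1 / ((q : ℝ) + 1) ^ n)) :=
        mul_le_mul_of_nonneg_left hu hL0
    _ = (1 / ((q : ℝ) + 1)) ^ k * (1 / ((q : ℝ) + 1) * ((1 - 1 / ((q : ℝ) + 1) ^ n) * L)) := by
        rw [one_div_pow, pow_succ]
        field_simp
    _ ≤ (1 / ((q : ℝ) + 1)) ^ k * (1 / (q : ℝ) * (g * ((1 - 1 / (q : ℝ) ^ n) *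
        (1 - 1 / (q : ℝ) ^ 2 * (1 - (q : ℝ) / (q : ℝ) ^ n))))) :=
        mul_le_mul_of_nonneg_left h (by positivity)
    _ ≤ (1 / (q : ℝ)) ^ k * (1 / (q : ℝ) * (g * ((1 - 1 / (q : ℝ) ^ n) *
        (1 - 1 / (q : ℝ) ^ 2 * (1 - (q : ℝ) / (q : ℝ) ^ n))))) := by
        refine mul_le_mul_of_nonneg_right (pow_le_pow_left₀ (by positivity)
          (one_div_le_one_div_of_le (by linarith) (by linarith)) k) ?_
        exact mul_nonneg (by positivity) (mul_nonneg hg0 hB)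
    _ = g * (1 / (q : ℝ) ^ (k + 1) * (1 - 1 / (q : ℝ) ^ n) *
        (1 - (1 / (q : ℝ)) ^ 2 * (1 - (q : ℝ) / (q : ℝ) ^ n))) := by
        rw [one_div_pow, one_div_pow, pow_succ]
        field_simp
        ring
    _ ≤ g * (1 / (q : ℝ) ^ (k + 1) * (1 - 1 / (q : ℝ) ^ n) *
        (1 - 1 / (q : ℝ) ^ (k + 2) * (1 - (q : ℝ) / (q : ℝ) ^ n))) := by
        refine mul_le_mul_of_nonneg_left (mul_le_mul_of_nonneg_left ?_
          (mul_nonneg (by positivity) hB1)) hg0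
        rw [← one_div_pow]
        have := mul_le_mul_of_nonneg_right hk (sub_nonneg.2 hqn)
        linarith
    _ ≤ g * (1 - stallProb q n (n + k)) := mul_le_mul_of_nonneg_left hl hg0
    _ ≤ _ := h2

theorem le_logb_ratio_pred {q : ℝ} {T j : ℕ} (hq : 1 < q) (hT : j + 2 ≤ T) :
    (T : ℝ) - (j + 1 : ℕ) + Real.logb q (1 + 1 / q) ≤
      Real.logb q ((q ^ T - q ^ j) / (q ^ (j + 1) - q ^ j)) := by
  have hq0 : 0 < q := by linarith
  obtain ⟨K, rfl⟩ := Nat.exists_eq_add_of_le hT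
  have h1 : 0 < q ^ (j + 1) - q ^ j := sub_pos.2 (pow_lt_pow_right₀ hq (by omega))
  rw [Real.le_logb_iff_rpow_le hq (div_pos (sub_pos.2 (pow_lt_pow_right₀ hq (by omega))) h1),
    Real.rpow_add hq0, Real.rpow_logb hq0 hq.ne' (by positivity), le_div_iff₀ h1,
    show ((j + 2 + K : ℕ) : ℝ) - (j + 1 : ℕ) = (K + 1 : ℕ) by push_cast; ring, Real.rpow_natCast]
  have e : q ^ (K + 1) * (1 + 1 / q) * (q ^ (j + 1) - q ^ j) =
      q ^ (j + 2 + K) - q ^ j * q ^ K := by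
    rw [pow_succ, pow_succ, pow_add, pow_add]
    field_simp
    ring
  rw [e]
  have := one_le_pow₀ (n := K) hq.le
  have h0 : 0 < q ^ j := by positivity
  nlinarith

/-- For `n = 1` the main terms for `q` and `q + 1` are too close to ignore the logarithmic
correction for `q`; it dominates the one for `q + 1`. -/
theorem rankGain_succ_le_one {q T : ℕ} (k : ℕ) (hq : 2 ≤ q) (hT : 1 + 1 < T) :
    rankGain ((q : ℝ) + 1) ((q : ℝ) + 1) 1 T 1 (1 + k) ≤ rankGain q q 1 T 1 (1 + k) := by
  have hqr : (2 : ℝ) ≤ q := by exact_mod_cast hq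
  have hTr : (3 : ℝ) ≤ T := by exact_mod_cast hT
  have hle : Real.logb ((q : ℝ) + 1) (1 + 1 / q) ≤ Real.logb q (1 + 1 / q) :=
    div_le_div_of_nonneg_left (Real.log_nonneg (by rw [le_add_iff_nonneg_right]; positivity))
      (Real.log_pos (by linarith)) (Real.log_le_log (by linarith) (by linarith))
  have h0 : 0 ≤ Real.logb ((q : ℝ) + 1) (1 + 1 / q) :=
    Real.logb_nonneg (by linarith) (by rw [le_add_iff_nonneg_right]; positivity)
  refine rankGain_succ_le_of_bound k hq le_rfl hT (g := (T : ℝ) - (1 : ℕ) +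
    Real.logb ((q : ℝ) + 1) (1 + 1 / q)) (by push_cast; linarith) (fun r hr => ?_) ?_
  · obtain rfl : r = 0 := by omega
    exact (add_le_add_right hle _).trans (le_logb_ratio_pred (by linarith) hT.le)
  · set L := (T : ℝ) - (1 : ℕ) + Real.logb ((q : ℝ) + 1) (1 + 1 / q) with hL
    have hL0 : 0 ≤ L := by rw [hL]; push_cast; linarith
    have e : 1 / (q : ℝ) * (L * ((1 - 1 / (q : ℝ) ^ 1) *
        (1 - 1 / (q : ℝ) ^ 2 * (1 - (q : ℝ) / (q : ℝ) ^ 1)))) -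
        1 / ((q : ℝ) + 1) * ((1 - 1 / ((q : ℝ) + 1) ^ 1) * L) =
        L * (((q : ℝ) * (q - 1) - 1) / ((q : ℝ) ^ 2 * (q + 1) ^ 2)) := by
      field_simp
      ring
    rw [← sub_nonneg, e]
    refine mul_nonneg hL0 (div_nonneg ?_ (by positivity))
    nlinarith

/-- The passage from `q = 2` to `3`. For `n = 2` the logarithmic correction for `q = 2` is at least
`1 / 3`; for larger `n` it is not needed. -/
theorem rankGain_three_le_two {n T : ℕ} (k : ℕ) (hn : 2 ≤ n) (hT : n + n < T) :
    rankGain ((2 : ℕ) + 1) ((2 : ℕ) + 1) n T n (n + k) ≤ rankGain (2 : ℕ) (2 : ℕ) n T n (n + k) := by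
  have hTr : (n : ℝ) + n + 1 ≤ T := by exact_mod_cast hT
  have hlam := logb_three_le
  rcases hn.eq_or_lt with rfl | hn
  · refine rankGain_succ_le_of_bound k le_rfl (by omega) hT (g := (T : ℝ) - (2 : ℕ) + 1 / 3)
      (by push_cast at hTr ⊢; linarith) (fun r hr => ?_) ?_
    · obtain ⟨K, rfl⟩ := Nat.exists_eq_add_of_le (show 2 + 3 ≤ T by omega)
      -- `1.26 ^ 3 > 2`
      have h126 : (2 : ℝ) ^ (1 / 3 : ℝ) ≤ 1.26 := by
        refine le_of_pow_le_pow_left₀ (n := 3) (by norm_num) (by norm_num) ?_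
        rw [← Real.rpow_natCast, ← Real.rpow_mul (by norm_num)]
        norm_num
      have hK : (1 : ℝ) ≤ 2 ^ K := one_le_pow₀ (by norm_num)
      have h4 := mul_le_mul_of_nonneg_left h126 (show (0 : ℝ) ≤ 2 ^ (K + 3) by positivity)
      have e8 : (2 : ℝ) ^ (K + 3) = 8 * 2 ^ K := by ring
      have e32 : (2 : ℝ) ^ (2 + 3 + K) = 32 * 2 ^ K := by ring
      rw [Nat.cast_ofNat, Real.le_logb_iff_rpow_le (by norm_num) (div_pos (sub_pos.2
        (pow_lt_pow_right₀ (by norm_num) (by omega))) (sub_pos.2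
        (pow_lt_pow_right₀ (by norm_num) (by omega)))), Real.rpow_add (by norm_num),
        show ((2 + 3 + K : ℕ) : ℝ) - 2 = (K + 3 : ℕ) by push_cast; ring, Real.rpow_natCast,
        le_div_iff₀ (sub_pos.2 (pow_lt_pow_right₀ (by norm_num) (by omega)))]
      rw [e8] at h4 ⊢
      rw [e32]
      generalize (2 : ℝ) ^ (1 / 3 : ℝ) = w at *
      interval_cases r <;> norm_num <;> linarith
    · have hT5 : (5 : ℝ) ≤ T := by exact_mod_cast hT
      norm_num at hlam ⊢
      linarith
  · refine rankGain_succ_le_of_bound k le_rfl (by omega) hT (g := (T : ℝ) - n) (by linarith)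
      (fun r hr => le_logb_ratio (by norm_num) hr (by omega)) ?_
    rcases (show 3 ≤ n from hn).eq_or_lt with rfl | hn
    · have hT7 : (7 : ℝ) ≤ T := by exact_mod_cast hT
      norm_num at hlam ⊢
      linarith
    rcases (show 4 ≤ n from hn).eq_or_lt with rfl | hn
    · have hT9 : (9 : ℝ) ≤ T := by exact_mod_cast hT
      norm_num at hlam ⊢
      linarith
    have hn5 : (5 : ℝ) ≤ n := by exact_mod_cast hn
    have hx : (1 : ℝ) / 2 ^ n ≤ 1 / 32 := one_div_le_one_div_of_le (by norm_num)
      (by have := pow_le_pow_right₀ (one_le_two (α := ℝ)) hn; norm_num at this; exact this)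
    have hx0 : (0 : ℝ) < 1 / 2 ^ n := by positivity
    have hy0 : (0 : ℝ) < 1 / (2 + 1) ^ n := by positivity
    have hl0 : 0 ≤ Real.logb (2 + 1) (1 + 1 / 2) := Real.logb_nonneg (by norm_num) (by norm_num)
    rw [Nat.cast_ofNat]
    set lam := Real.logb (2 + 1) (1 + 1 / 2)
    set K := (T : ℝ) - n with hK
    have e1 : (1 - 1 / (2 + 1) ^ n) * (K + lam) ≤ K + 3 / 8 :=
      (mul_le_of_le_one_left (by linarith) (by linarith)).trans (by linarith)
    have e2 : 31 / 32 * (3 / 4) ≤ (1 - 1 / (2 : ℝ) ^ n) * (1 - 1 / 2 ^ 2 * (1 - 2 / 2 ^ n)) := by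
      have : (2 : ℝ) / 2 ^ n = 2 * (1 / 2 ^ n) := by ring
      rw [this]
      exact mul_le_mul (by linarith) (by linarith) (by norm_num) (by linarith)
    have e3 := mul_le_mul_of_nonneg_left e2 (show 0 ≤ K by linarith)
    norm_num only at e1 e3 ⊢
    linarith

theorem rankGain_succ_le_of_three_le {q n T : ℕ} (k : ℕ) (hq : 3 ≤ q) (hn : 2 ≤ n)
    (hT : n + n < T) :
    rankGain ((q : ℝ) + 1) ((q : ℝ) + 1) n T n (n + k) ≤ rankGain q q n T n (n + k) := by
  have hqr : (3 : ℝ) ≤ q := by exact_mod_cast hq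
  have hnr : (2 : ℝ) ≤ n := by exact_mod_cast hn
  have hTr : (n : ℝ) + n + 1 ≤ T := by exact_mod_cast hT
  refine rankGain_succ_le_of_bound k (by omega) (by omega) hT (g := (T : ℝ) - n) (by linarith)
      (fun r hr => le_logb_ratio (by linarith) hr (by omega)) ?_
  set K := (T : ℝ) - n with hK
  have hlam : Real.logb ((q : ℝ) + 1) (1 + 1 / q) ≤ 0.73 * (1 / q) := by
    refine (logb_succ_le (by linarith)).trans ?_
    have h1 : (1.38 : ℝ) ≤ Real.log ((q : ℝ) + 1) := by
      have h2 := Real.log_le_log (show (0 : ℝ) < 2 ^ 2 by norm_num)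
        (show (2 : ℝ) ^ 2 ≤ (q : ℝ) + 1 by linarith)
      rw [Real.log_pow] at h2
      push_cast at h2
      linarith [Real.log_two_gt_d9]
    rw [div_le_iff₀ (by linarith)]
    have h3 : 0 < 1 / (q : ℝ) := by positivity
    nlinarith
  have hl0 : 0 ≤ Real.logb ((q : ℝ) + 1) (1 + 1 / q) :=
    Real.logb_nonneg (by linarith) (by rw [le_add_iff_nonneg_right]; positivity)
  set lam := Real.logb ((q : ℝ) + 1) (1 + 1 / q)
  obtain ⟨x, hx⟩ : ∃ x, x = 1 / (q : ℝ) := ⟨_, rfl⟩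
  have hx0 : 0 < x := by rw [hx]; positivity
  have hx3 : x ≤ 1 / 3 := by rw [hx]; exact one_div_le_one_div_of_le (by norm_num) hqr
  have hR : (1 - x ^ 2) * (1 - x ^ 2 + x ^ 3) ≤
      (1 - 1 / (q : ℝ) ^ n) * (1 - 1 / (q : ℝ) ^ 2 * (1 - (q : ℝ) / (q : ℝ) ^ n)) := by
    have e1 : (q : ℝ) / (q : ℝ) ^ n = x ^ (n - 1) := by
      obtain ⟨n, rfl⟩ := Nat.exists_eq_add_of_le' (show 1 ≤ n by omega)
      rw [Nat.add_sub_cancel, hx, one_div_pow, pow_succ]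
      field_simp
    rw [e1, ← one_div_pow, ← one_div_pow, ← hx]
    rcases hn.eq_or_lt with rfl | hn
    · apply le_of_eq
      ring
    · have h1 : x ^ n ≤ x ^ 3 := pow_le_pow_of_le_one hx0.le (by linarith) hn
      have h2 : 0 < x ^ (n - 1) := by positivity
      have h3 : 2 * x ^ 3 ≤ x ^ 2 := by nlinarith [sq_nonneg x, pow_pos hx0 2]
      have h4 : x ^ 2 ≤ 1 / 9 := by nlinarith
      calc (1 - x ^ 2) * (1 - x ^ 2 + x ^ 3) ≤ (1 - x ^ 2) * (1 - x ^ 3) :=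
            mul_le_mul_of_nonneg_left (by linarith) (by linarith)
        _ = (1 - x ^ 3) * (1 - x ^ 2 * 1) := by ring
        _ ≤ _ := by
          refine mul_le_mul (by linarith) ?_ (by linarith) (by linarith)
          nlinarith
  have e1 : (1 - 1 / ((q : ℝ) + 1) ^ n) * (K + lam) ≤ K + lam :=
    mul_le_of_le_one_left (by linarith) (by rw [sub_le_self_iff]; positivity)
  have e2 : K + lam ≤ K * (1 + 0.25 * x) := by
    rw [← hx] at hlam
    nlinarith
  -- this is where the main terms win over the correction: `1 + x` against `1 + x / 4`
  have e3 : 1 + 0.25 * x ≤ (1 + x) * ((1 - x ^ 2) * (1 - x ^ 2 + x ^ 3)) := by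
    have : (1 + x) * ((1 - x ^ 2) * (1 - x ^ 2 + x ^ 3)) - (1 + 0.25 * x) =
      x * (0.75 - 2 * x - x ^ 2 + 2 * x ^ 3 - x ^ 5) := by ring
    rw [← sub_nonneg, this]
    refine mul_nonneg hx0.le ?_
    have h1 : x ^ 5 ≤ x ^ 3 / 9 := by
      have : x ^ 2 ≤ 1 / 9 := by nlinarith
      have h0 : 0 < x ^ 3 := by positivity
      nlinarith
    -- the tangent of `x ↦ x ^ 3` at `1 / 3`
    have h2 : 0 ≤ (x - 1 / 3) ^ 2 * (x + 2 / 3) := by positivity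
    nlinarith
  have e4 : 1 / ((q : ℝ) + 1) * (K * (1 + 0.25 * x)) ≤
      1 / ((q : ℝ) + 1) * (K * ((1 + x) * ((1 - x ^ 2) * (1 - x ^ 2 + x ^ 3)))) :=
    mul_le_mul_of_nonneg_left (mul_le_mul_of_nonneg_left e3 (by linarith)) (by positivity)
  have e5 : 1 / ((q : ℝ) + 1) * (1 + x) = x := by
    rw [hx]
    field_simp
  calc _ ≤ 1 / ((q : ℝ) + 1) * (K * (1 + 0.25 * x)) :=
        mul_le_mul_of_nonneg_left (e1.trans e2) (by positivity)
    _ ≤ _ := e4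
    _ = (1 / ((q : ℝ) + 1) * (1 + x)) * (K * ((1 - x ^ 2) * (1 - x ^ 2 + x ^ 3))) := by ring
    _ = 1 / (q : ℝ) * (K * ((1 - x ^ 2) * (1 - x ^ 2 + x ^ 3))) := by rw [e5, hx]
    _ ≤ _ := mul_le_mul_of_nonneg_left (mul_le_mul_of_nonneg_left hR (by linarith))
      (by positivity)

/-- The upper inequalities get easier when the field size grows. -/
theorem rankGain_succ_le {q n T : ℕ} (k : ℕ) (hq : 2 ≤ q) (hn : 1 ≤ n) (hT : n + n < T) :
    rankGain ((q : ℝ) + 1) ((q : ℝ) + 1) n T n (n + k) ≤ rankGain q q n T n (n + k) := by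
  rcases hn.eq_or_lt with rfl | hn
  · exact rankGain_succ_le_one k hq hT
  rcases hq.eq_or_lt with rfl | hq
  · exact rankGain_three_le_two k hn hT
  · exact rankGain_succ_le_of_three_le k hq hn hT

/-! ### Range of validity of the inequalities -/

theorem gainInequalities_succ {q m n T : ℕ} (hq : 2 ≤ q) (hn : 1 ≤ n) (hT : n + min m n < T)
    (h : GainInequalities q m n T) : GainInequalities ((q : ℝ) + 1) m n T := by
  have hqr : (2 : ℝ) ≤ q := by exact_mod_cast hq
  constructor
  · intro l hl
    rcases le_or_gt (n + 1) ((q + 1) ^ (n - min m n + 1)) with hp | hp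
    · have h1 : ∀ j ∈ Finset.Ico l (min m n),
          (n : ℝ) ≤ rankGain ((q : ℝ) + 1) ((q : ℝ) + 1) n T (min m n) j := fun j hj =>
        le_rankGain_of_le_pow (by linarith) (min_le_right m n) hT (Finset.mem_Ico.1 hj).2
          (by exact_mod_cast hp)
      have h2 := Finset.card_nsmul_le_sum _ _ _ h1
      rw [Nat.card_Ico, nsmul_eq_mul, Nat.cast_sub hl.le, mul_comm] at h2
      exact h2
    · exact (h.1 l hl).trans (Finset.sum_le_sum fun j hj =>
        rankGain_le_succ hq (min_le_right m n) hT (Finset.mem_Ico.1 hj).2 hp)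
  · intro l hl hlm
    have hi : min m n = n := by omega
    refine le_trans (Finset.sum_le_sum fun j hj => ?_) (h.2 l hl hlm)
    rw [hi] at hj hT ⊢
    obtain ⟨k, rfl⟩ := Nat.exists_eq_add_of_le (Finset.mem_Ico.1 hj).1
    exact rankGain_succ_le k hq hn hT

theorem gainInequalities_of_le {q q' m n T : ℕ} (hq : 2 ≤ q) (hqq : q ≤ q') (hn : 1 ≤ n)
    (hT : n + min m n < T) (h : GainInequalities q m n T) : GainInequalities q' m n T := by
  induction q', hqq using Nat.le_induction with
  | base => exact h
  | succ q' hqq ih =>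
    rw [Nat.cast_add_one]
    exact gainInequalities_succ (hq.trans hqq) hn hT ih

theorem gainInequalities_of_mul_le {q m n T : ℕ} (hn : 1 ≤ n) (hT : n + min m n < T)
    (h : n * T ≤ q) : GainInequalities q m n T := by
  have hTq : T ≤ q := le_trans (Nat.le_mul_of_pos_left T hn) h
  have hTqr : (T : ℝ) ≤ q := by exact_mod_cast hTq
  have hqr : (2 : ℝ) ≤ q := by exact_mod_cast (show 2 ≤ q by omega)
  have hnr : (1 : ℝ) ≤ n := by exact_mod_cast hn
  have hTr : (n : ℝ) + 1 ≤ T := by exact_mod_cast (show n + 1 ≤ T by omega)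
  constructor
  · intro l hl
    have h1 : ∀ j ∈ Finset.Ico l (min m n), (n : ℝ) ≤ rankGain q q n T (min m n) j := fun j hj =>
      le_rankGain_of_le_pow (by linarith) (min_le_right m n) hT (Finset.mem_Ico.1 hj).2
        (by
          have := le_self_pow₀ (show (1 : ℝ) ≤ q by linarith) (show n - min m n + 1 ≠ 0 by omega)
          linarith)
    have h2 := Finset.card_nsmul_le_sum _ _ _ h1
    rwa [Nat.card_Ico, nsmul_eq_mul, Nat.cast_sub hl.le, mul_comm] at h2
  · intro l hl hlm
    have hi : min m n = n := by omega
    rw [hi] at hl hT ⊢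
    have h1 : ∀ j ∈ Finset.Ico n l, rankGain q q n T n j ≤ n := by
      intro j hj
      obtain ⟨k, rfl⟩ := Nat.exists_eq_add_of_le (Finset.mem_Ico.1 hj).1
      have h2 := rankGain_le_mul_one_sub_stallProb (q := q) (n := n) (T := T) (i := n)
        (j := n + k) (by linarith) fun r hr _ => logb_ratio_le_of_add_le (by linarith) le_rfl
          (show r + 1 ≤ n by omega) (by omega)
      have h3 : -Real.logb q (1 - 1 / (q : ℝ) ^ 1) ≤ 1 := by
        rw [← Real.logb_inv, Real.logb_le_iff_le_rpow (by linarith), Real.rpow_one, pow_one]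
        · rw [inv_le_comm₀ _ (by linarith), ← one_div]
          · have : 1 / (q : ℝ) ≤ 1 / 2 := one_div_le_one_div_of_le (by norm_num) hqr
            linarith
          · rw [sub_pos, div_lt_one (by linarith)]
            linarith
        · rw [inv_pos, pow_one, sub_pos, div_lt_one (by linarith)]
          linarith
      have h4 : 1 - stallProb q n (n + k) ≤ 1 / q := by
        refine (one_sub_stallProb_le (by linarith) n k).trans ?_
        refine (mul_le_of_le_one_right (by positivity)
          (by rw [sub_le_self_iff]; positivity)).trans ?_
        exact one_div_le_one_div_of_le (by linarith) (le_self_pow₀ (by linarith) (by omega))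
      have h5 := sub_nonneg.2 (stallProb_le_one (q := q) (by linarith) n (n + k))
      calc _ ≤ _ := h2
        _ ≤ q * (1 / q) := mul_le_mul (by linarith) h4 h5 (by linarith)
        _ = 1 := by field_simp
        _ ≤ _ := hnr
    have h2 := Finset.sum_le_card_nsmul _ _ _ h1
    rwa [Nat.card_Ico, nsmul_eq_mul, Nat.cast_sub (by omega), mul_comm] at h2

/-- A column stalls with probability at most `1 / 2`, so that each gain is at least `(T - m) / 2`.
-/
theorem gainInequalities_of_large {q : ℝ} {m n T : ℕ} (hq : 2 ≤ q) (hmn : m ≤ n)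
    (hT : 2 * n + m ≤ T) : GainInequalities q m n T := by
  have hTr : 2 * (n : ℝ) + m ≤ T := by exact_mod_cast hT
  rw [GainInequalities, min_eq_left hmn]
  refine ⟨fun l hl => ?_, fun l hl hlm => by omega⟩
  have h1 : ∀ j ∈ Finset.Ico l m, (n : ℝ) ≤ rankGain q q n T m j := by
    intro j hj
    have hj := (Finset.mem_Ico.1 hj).2
    refine le_trans ?_ (mul_one_sub_stallProb_le_rankGain (by linarith) fun r _ hrj =>
      le_logb_ratio (by linarith) (show r < m by omega) (by omega))
    have h2 : stallProb q n j ≤ 1 / 2 := (stallProb_le (by linarith) (by omega)).trans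
      (one_div_le_one_div_of_le (by norm_num)
        (hq.trans (le_self_pow₀ (by linarith) (by omega))))
    nlinarith [Nat.cast_nonneg (α := ℝ) n]
  have h2 := Finset.card_nsmul_le_sum _ _ _ h1
  rwa [Nat.card_Ico, nsmul_eq_mul, Nat.cast_sub hl.le, mul_comm] at h2

/-! ### Expansion for large fields -/

/-- Before the last column, stalling and the logarithmic correction are of second order. -/
theorem abs_rankGain_sub_le {q : ℝ} {n T i j : ℕ} (hq : 2 ≤ q) (hj : j + 2 ≤ i) (hi : i ≤ n)
    (hT : i ≤ T) :
    |rankGain q q n T i j - ((T : ℝ) - i)| ≤ ((T : ℝ) - i + 5) * (1 / q) ^ 2 := by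
  have hTr : (i : ℝ) ≤ T := by exact_mod_cast hT
  have hl : 0.69 ≤ Real.log q := by
    have := Real.log_le_log (by norm_num) hq
    linarith [Real.log_two_gt_d9]
  have h1 := rankGain_le_mul_one_sub_stallProb (q := q) (n := n) (T := T) (i := i)
    (j := j) (by linarith) fun r _ hrj => logb_ratio_le_of_add_le (by linarith) one_le_two
      (show r + 2 ≤ i by omega) hT
  have h2 := mul_one_sub_stallProb_le_rankGain (q := q) (n := n) (T := T) (i := i)
    (j := j) (by linarith) fun r _ hrj => le_logb_ratio (by linarith) (show r < i by omega) hT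
  have h3 : stallProb q n j ≤ (1 / q) ^ 2 := by
    rw [one_div_pow]
    exact (stallProb_le (by linarith) (by omega)).trans (one_div_le_one_div_of_le (by positivity)
      (pow_le_pow_right₀ (by linarith) (by omega)))
  have h0 := stallProb_nonneg (q := q) (by linarith) n j
  have hx : 1 / q ≤ 1 / 2 := one_div_le_one_div_of_le (by norm_num) hq
  have hx0 : 0 < 1 / q := by positivity
  rw [← one_div_pow, sub_eq_add_neg] at h1
  have hx2 : (1 / q) ^ 2 ≤ 1 / 4 := by nlinarith
  have hx2' : 0 < (1 / q) ^ 2 := by positivity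
  set z := (1 / q) ^ 2
  have h4 : -Real.logb q (1 - z) ≤ 2 * z := by
    have h5 := neg_log_one_sub_le (show z < 1 by linarith)
    have h6 : z / (1 - z) ≤ 4 / 3 * z := by
      rw [div_le_iff₀ (by linarith)]
      nlinarith
    rw [Real.logb, ← neg_div, div_le_iff₀ (by linarith)]
    nlinarith
  have h5 : 0 ≤ -Real.logb q (1 - z) := by
    rw [← neg_zero, neg_le_neg_iff]
    exact Real.logb_nonpos (by linarith) (by linarith) (by linarith)
  rw [abs_le]
  constructor <;> nlinarith

theorem neg_logb_one_sub_le_add {q x : ℝ} (hl : 0.69 ≤ Real.log q) (hx0 : 0 < x)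
    (hx : x ≤ 1 / 2) : -Real.logb q (1 - x) ≤ x / Real.log q + 3 * x ^ 2 := by
  have h5 := neg_log_one_sub_le (show x < 1 by linarith)
  have h6 : x / (1 - x) ≤ x + 2 * x ^ 2 := by
    rw [div_le_iff₀ (by linarith)]
    nlinarith [pow_pos hx0 2]
  rw [Real.logb, ← neg_div, div_le_iff₀ (by linarith), add_mul, div_mul_cancel₀ _ (by linarith)]
  nlinarith [pow_pos hx0 2]

theorem sub_le_mul_logb_one_add {q x : ℝ} (hl : 0.69 ≤ Real.log q) (hx0 : 0 < x)
    (hx : x ≤ 1 / 2) :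
    x / Real.log q - 5 * x ^ 2 ≤ (1 - x) * Real.logb q (1 + x) * (1 - 2 * x ^ 2) := by
  have hlog : x - x ^ 2 ≤ Real.log (1 + x) := by
    have := Real.one_sub_inv_le_log_of_pos (show 0 < 1 + x by linarith)
    refine le_trans ?_ this
    have e : 1 - (1 + x)⁻¹ - (x - x ^ 2) = x ^ 3 / (1 + x) := by
      field_simp
      ring
    rw [← sub_nonneg, e]
    positivity
  have hx2 : x ^ 2 ≤ 1 / 4 := by nlinarith
  have e1 : x - 3 * x ^ 2 ≤ (1 - x) * (1 - 2 * x ^ 2) * Real.log (1 + x) := by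
    refine le_trans ?_ (mul_le_mul_of_nonneg_left hlog
      (mul_nonneg (by linarith) (by linarith)))
    have e : (1 - x) * (1 - 2 * x ^ 2) * (x - x ^ 2) - (x - 3 * x ^ 2) =
        x ^ 2 * (1 - x + 2 * x * (2 * x - x ^ 2)) := by ring
    rw [← sub_nonneg, e]
    refine mul_nonneg (by positivity) ?_
    nlinarith
  have e2 : (1 - x) * Real.logb q (1 + x) * (1 - 2 * x ^ 2) =
      (1 - x) * (1 - 2 * x ^ 2) * Real.log (1 + x) / Real.log q := by
    rw [Real.logb]
    ring
  rw [e2, le_div_iff₀ (by linarith), sub_mul, div_mul_cancel₀ _ (by linarith)]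
  nlinarith [pow_pos hx0 2]

/-- The last column stalls with probability about `1 / q` if `n ≤ j + 1`, and of second order
otherwise; its logarithmic correction is about `log_q (1 + 1 / q)`. -/
theorem abs_rankGain_pred_sub_le {q : ℝ} {n T j : ℕ} (hq : 2 ≤ q) (hj : j + 1 ≤ n)
    (hT : j + 2 ≤ T) :
    |rankGain q q n T (j + 1) j - ((T : ℝ) - (j + 1 : ℕ) -
      (if n ≤ j + 1 then 1 else 0) * ((T : ℝ) - (j + 1 : ℕ)) * (1 / q) + 1 / q / Real.log q)| ≤
      ((T : ℝ) - (j + 1 : ℕ) + 5) * (1 / q) ^ 2 := by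
  have hTr : ((j + 1 : ℕ) : ℝ) ≤ T := by exact_mod_cast (show j + 1 ≤ T by omega)
  have hl : 0.69 ≤ Real.log q := by
    have := Real.log_le_log (by norm_num) hq
    linarith [Real.log_two_gt_d9]
  have hx : 1 / q ≤ 1 / 2 := one_div_le_one_div_of_le (by norm_num) hq
  have hx0 : 0 < 1 / q := by positivity
  obtain ⟨x, hxdef⟩ : ∃ x, x = 1 / q := ⟨_, rfl⟩
  rw [← hxdef] at hx hx0
  obtain ⟨s, hs⟩ : ∃ s, s = n - j := ⟨_, rfl⟩
  set δ : ℝ := if n ≤ j + 1 then 1 else 0 with hδ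
  have hlow := le_stallProb (q := q) (n := n) (j := j) (by linarith) (by omega)
  have hup := stallProb_le (q := q) (n := n) (j := j) (by linarith) (by omega)
  rw [← hs] at hlow hup
  have hlow' : x ^ s - x ^ (2 * s + 1) ≤ stallProb q n j := by
    refine le_trans ?_ hlow
    rw [← one_div_pow, ← one_div_pow, ← hxdef]
    have : x ^ (2 * s + 1) * (1 - 1 / q ^ j) ≤ x ^ (2 * s + 1) :=
      mul_le_of_le_one_right (by positivity) (by rw [sub_le_self_iff]; positivity)
    linarith
  rw [← one_div_pow, ← hxdef] at hup
  have hxs : δ * x ≤ x ^ s ∧ x ^ s ≤ δ * x + x ^ 2 := by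
    rw [hδ]
    split_ifs with h
    · rw [show s = 1 by omega]
      constructor <;> nlinarith
    · have := pow_le_pow_of_le_one hx0.le (by linarith) (show 2 ≤ s by omega)
      have h0 : 0 < x ^ s := by positivity
      constructor <;> linarith
  have hxs2 : x ^ (2 * s + 1) ≤ x ^ 2 :=
    pow_le_pow_of_le_one hx0.le (by linarith) (by omega)
  have ha0 := stallProb_nonneg (q := q) (by linarith) n j
  have h1 := rankGain_le_mul_one_sub_stallProb (q := q) (n := n) (T := T) (i := j + 1)
    (j := j) (by linarith) fun r _ hrj => logb_ratio_le_of_add_le (by linarith) le_rfl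
      (show r + 1 ≤ j + 1 by omega) (by omega)
  rw [pow_one, ← hxdef, sub_eq_add_neg] at h1
  have h4 := neg_logb_one_sub_le_add hl hx0 hx
  have h5 : 0 ≤ -Real.logb q (1 - x) := by
    rw [← neg_zero, neg_le_neg_iff]
    exact Real.logb_nonpos (by linarith) (by linarith) (by linarith)
  set K := (T : ℝ) - (j + 1 : ℕ) with hK
  have hK0 : 0 ≤ K := by linarith
  set μ := Real.logb q (1 + x) with hμ
  have hμ0 : 0 ≤ μ := Real.logb_nonneg (by linarith) (by linarith)
  -- `2 * q ^ s * y - 1` is a lower bound for the indicator of full rank, linear in the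
  -- probability `y` of stalling
  have h2 : K * (1 - stallProb q n j) + (1 - x) * μ * (2 * q ^ s * stallProb q n j - 1) ≤
      rankGain q q n T (j + 1) j := by
    have e : K * (1 - stallProb q n j) + (1 - x) * μ * (2 * q ^ s * stallProb q n j - 1) =
        rankMean q n j fun r => (K - (1 - x) * μ) +
          ((1 - x) * μ * (2 * q ^ s) - K) * (q ^ r / q ^ n) := by
      rw [rankMean_add, rankMean_const, rankMean_const_mul, ← stallProb]
      ring
    rw [e]
    refine rankMean_le_rankGain (by linarith) (fun hj => by omega) fun r hr hrj => ?_
    have h0 := one_sub_pow_div_nonneg (q := q) (by linarith) hr.le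
    have hμ' : 0 ≤ (1 - x) * μ := mul_nonneg (by linarith) hμ0
    rcases hrj.eq_or_lt with rfl | hrj
    · have hy : q ^ r / q ^ n = x ^ s := by
        rw [hxdef, one_div_pow, hs, ← pow_div_pow_eq (by linarith) hr.le, one_div_div]
      have hy2 : q ^ s * x ^ s = 1 := by
        rw [hxdef, one_div_pow, mul_one_div_cancel (by positivity)]
      have hc := mul_le_mul_of_nonneg_left (le_logb_ratio_pred (q := q) (by linarith) hT) h0
      refine le_trans ?_ hc
      rw [← hxdef, ← hK, ← hμ, hy]
      have hxs1 : x ^ s ≤ x := pow_le_of_le_one hx0.le (by linarith) (by omega)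
      have e1 : (K - (1 - x) * μ) + ((1 - x) * μ * (2 * q ^ s) - K) * x ^ s =
          (1 - x ^ s) * K + (1 - x) * μ * (2 * (q ^ s * x ^ s) - 1) := by ring
      rw [e1, hy2]
      have := mul_le_mul_of_nonneg_right (show 1 - x ≤ 1 - x ^ s by linarith) hμ0
      linarith
    · have hy : q ^ r / q ^ n ≤ 1 / q ^ (s + 1) :=
        pow_div_pow_le_one_div (by linarith) (by omega)
      have hy' : 2 * q ^ s * (q ^ r / q ^ n) ≤ 1 := by
        refine (mul_le_mul_of_nonneg_left hy (by positivity)).trans ?_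
        rw [pow_succ, mul_one_div, div_le_one (by positivity)]
        nlinarith [pow_pos (show 0 < q by linarith) s]
      have hc := mul_le_mul_of_nonneg_left
        (le_logb_ratio (q := q) (T := T) (i := j + 1) (r := r) (by linarith) (by omega)
          (by omega)) h0
      refine le_trans ?_ hc
      rw [← hK]
      have := mul_le_mul_of_nonneg_left hy' hμ'
      linarith
  have h6 : 1 - 2 * x ^ 2 ≤ 2 * q ^ s * stallProb q n j - 1 := by
    have e1 : q ^ s * x ^ s = 1 := by
      rw [hxdef, one_div_pow, mul_one_div_cancel (by positivity)]
    have e2 : q ^ s * x ^ (2 * s + 1) ≤ x ^ 2 := by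
      rw [show 2 * s + 1 = s + (s + 1) by ring, pow_add, ← mul_assoc, e1, one_mul]
      exact pow_le_pow_of_le_one hx0.le (by linarith) (by omega)
    have := mul_le_mul_of_nonneg_left hlow' (show 0 ≤ q ^ s by positivity)
    linarith
  have h7 := sub_le_mul_logb_one_add hl hx0 hx
  have h8 := mul_le_mul_of_nonneg_left h6 (mul_nonneg (show 0 ≤ 1 - x by linarith) hμ0)
  have h9 := mul_le_mul_of_nonneg_left (show stallProb q n j ≤ δ * x + x ^ 2 by
    linarith [hxs.2]) hK0
  have h10 := mul_le_mul_of_nonneg_left (show δ * x - x ^ 2 ≤ stallProb q n j by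
    linarith [hxs.1]) hK0
  rw [← hxdef]
  rw [abs_le]
  have h11 := mul_nonneg h5 ha0
  constructor <;> linarith

/-- The expansion of the gain `∑ j < i, rankGain` in powers of `1 / q`. -/
theorem abs_sum_rankGain_sub_le {q : ℝ} {n T i : ℕ} (hq : 2 ≤ q) (hi1 : 1 ≤ i) (hi : i ≤ n)
    (hT : i + 1 ≤ T) :
    |∑ j ∈ Finset.range i, rankGain q q n T i j - (i * ((T : ℝ) - i) -
      (if n ≤ i then 1 else 0) * ((T : ℝ) - i) * (1 / q) + 1 / q / Real.log q)| ≤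
      i * (((T : ℝ) - i + 5) * (1 / q) ^ 2) := by
  obtain ⟨j, rfl⟩ := Nat.exists_eq_add_of_le' hi1
  have h1 := abs_rankGain_pred_sub_le hq hi (show j + 2 ≤ T by omega)
  have h2 : |∑ k ∈ Finset.range j, (rankGain q q n T (j + 1) k - ((T : ℝ) - (j + 1 : ℕ)))| ≤
      j * (((T : ℝ) - (j + 1 : ℕ) + 5) * (1 / q) ^ 2) := by
    refine (Finset.abs_sum_le_sum_abs _ _).trans ?_
    refine (Finset.sum_le_card_nsmul _ _ _ fun k hk => abs_rankGain_sub_le hq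
      (show k + 2 ≤ j + 1 by rw [Finset.mem_range] at hk; omega) hi (by omega)).trans_eq ?_
    rw [Finset.card_range, nsmul_eq_mul]
  rw [Finset.sum_sub_distrib, Finset.sum_const, Finset.card_range, nsmul_eq_mul] at h2
  rw [Finset.sum_range_succ]
  have h3 := (abs_add_le _ _).trans (add_le_add h2 h1)
  refine le_trans (le_of_eq ?_) (h3.trans_eq ?_)
  · congr 1
    push_cast
    ring
  · push_cast
    ring

/-- `C * log₂ q / q` tends to zero. -/
theorem exists_forall_mul_logb_le (C ε : ℝ) (hε : 0 < ε) :
    ∃ N : ℕ, ∀ q : ℕ, N ≤ q → C * Real.logb 2 q * (1 / (q : ℝ)) ≤ ε := by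
  have h1 : Tendsto (fun x : ℝ => Real.log x / x) atTop (nhds 0) :=
    Real.isLittleO_log_id_atTop.tendsto_div_nhds_zero
  have h2 : Tendsto (fun q : ℕ => C * Real.logb 2 q * (1 / (q : ℝ))) atTop (nhds 0) := by
    have h3 := (h1.comp tendsto_natCast_atTop_atTop).const_mul (C / Real.log 2)
    rw [mul_zero] at h3
    refine h3.congr fun q => ?_
    simp only [Function.comp, Real.logb]
    ring
  exact eventually_atTop.1 (h2.eventually (Iic_mem_nhds hε))

end NonCoherent

theorem mainTheorem4 (m n : ℕ) (hm : 1 ≤ m) (hn : 1 ≤ n) :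
    (∀ T : ℕ, n + min m n < T →
      -- the minimum field size `q₀`, and the capacity for all field sizes `q ≥ q₀`
      (∃ q₀ : ℕ, IsLeast (NonCoherent.admissibleSizes m n T) q₀ ∧
        ∀ (F : Type u) [Field F] [Fintype F], q₀ ≤ Fintype.card F →
          IsGreatest (NonCoherent.mutualInformation n '' NonCoherent.inputDistributions F m T)
            (NonCoherent.capacity F m n T) ∧
          NonCoherent.capacity F m n T =
            ∑ l ∈ Finset.range (min m n + 1),
              (NonCoherent.psiNum F n l : ℝ) * (NonCoherent.gaussNum F (min m n) l : ℝ) *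
                ((Fintype.card F : ℝ) ^ (n * min m n))⁻¹ *
                Real.logb 2 ((NonCoherent.gaussNum F T l : ℝ) /
                  (NonCoherent.gaussNum F (min m n) l : ℝ)) ∧
          -- one matrix for each `min m n`-dimensional subspace, equiprobably
          (∃ C : Set (Matrix (Fin m) (Fin T) F),
            Set.BijOn NonCoherent.rowSpace C (NonCoherent.grassmannian F T (min m n)) ∧
            NonCoherent.IsCapacityAchieving n (NonCoherent.uniformOn C)) ∧
          -- any input whose row space is uniform over these subspaces
          (∀ P ∈ NonCoherent.inputDistributions F m T,
            (∀ π ∈ NonCoherent.grassmannian F T (min m n),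
              NonCoherent.rowSpaceLaw P π = (NonCoherent.gaussNum F T (min m n) : ℝ)⁻¹) →
            NonCoherent.IsCapacityAchieving n P)) ∧
      -- the expansion of the capacity, with an error `o(1 / q)` as `q → ∞`
      (∀ ε : ℝ, 0 < ε → ∃ N : ℕ, ∀ (F : Type u) [Field F] [Fintype F], N ≤ Fintype.card F →
        |NonCoherent.capacity F m n T -
          (((min m n : ℕ) : ℝ) * ((T : ℝ) - (min m n : ℕ)) * Real.logb 2 (Fintype.card F) -
            (if n ≤ m then 1 else 0) * ((T : ℝ) - (min m n : ℕ)) *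
              (Real.logb 2 (Fintype.card F) / Fintype.card F) +
            Real.logb 2 (Real.exp 1) * (Fintype.card F : ℝ)⁻¹)| ≤
          ε * (Fintype.card F : ℝ)⁻¹)) ∧
    -- for all large `T`, sufficient conditions for a field size to satisfy the inequalities
    (m ≤ n → ∀ᶠ T : ℕ in atTop, ∀ (F : Type u) [Field F] [Fintype F],
      5 * m ^ 2 ≤ Fintype.card F ^ (n - m + 1) → NonCoherent.SatisfiesInequalities F m n T) ∧
    (n < m → ∀ᶠ T : ℕ in atTop, ∀ (F : Type u) [Field F] [Fintype F],
      n * T ≤ Fintype.card F → NonCoherent.SatisfiesInequalities F m n T) := by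
  refine ⟨fun T hT => ⟨?_, ?_⟩, ?_, ?_⟩
  · -- the admissible sizes are nonempty, as they contain all large prime numbers
    have hne : (NonCoherent.admissibleSizes m n T).Nonempty := by
      obtain ⟨p, hp, hpp⟩ := Nat.exists_infinite_primes (n * T)
      have : Fact p.Prime := ⟨hpp⟩
      refine ⟨p, ZMod p, inferInstance, inferInstance, ZMod.card p, ?_⟩
      rw [NonCoherent.satisfiesInequalities_iff_gain _ hn hT, ZMod.card]
      exact NonCoherent.gainInequalities_of_mul_le hn hT hp
    refine ⟨sInf (NonCoherent.admissibleSizes m n T), ⟨Nat.sInf_mem hne, fun q hq => Nat.sInf_le hq⟩,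
      fun F _ _ hF => ?_⟩
    obtain ⟨F₀, _, _, hcard, h₀⟩ := Nat.sInf_mem hne
    rw [NonCoherent.satisfiesInequalities_iff_gain _ hn hT] at h₀
    have hsat : NonCoherent.SatisfiesInequalities F m n T := by
      rw [NonCoherent.satisfiesInequalities_iff_gain _ hn hT]
      exact NonCoherent.gainInequalities_of_le Fintype.one_lt_card (hcard.trans_le hF) hn hT h₀
    obtain ⟨hgreatest, hcap⟩ := NonCoherent.capacity_eq_rateSum hn hT hsat
    have hiT : min m n ≤ T := by omega
    refine ⟨hcap ▸ hgreatest, ?_, ?_, fun P hP hlaw => ⟨hP, ?_⟩⟩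
    · rw [hcap, NonCoherent.rateSum, min_eq_right (min_le_right m n)]
    · obtain ⟨C, hC⟩ := NonCoherent.exists_bijOn_rowSpace (F := F) (T := T) (min_le_left m n)
      obtain ⟨hmem, hlaw⟩ := NonCoherent.uniformOn_mem hiT hC
      exact ⟨C, hC, hmem, by rw [hcap, NonCoherent.mutualInformation_eq_rateSum hiT hmem hlaw]⟩
    · rw [hcap, NonCoherent.mutualInformation_eq_rateSum hiT hP hlaw]
  · intro ε hε
    obtain ⟨N, hN⟩ := NonCoherent.exists_forall_mul_logb_le
      ((min m n : ℕ) * ((T : ℝ) - (min m n : ℕ) + 5)) ε hε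
    refine ⟨max N (n * T), fun F _ _ hF => ?_⟩
    have hq1 : 2 ≤ Fintype.card F := Fintype.one_lt_card
    have hq2 : (2 : ℝ) ≤ Fintype.card F := by exact_mod_cast hq1
    have hsat : NonCoherent.SatisfiesInequalities F m n T := by
      rw [NonCoherent.satisfiesInequalities_iff_gain _ hn hT]
      exact NonCoherent.gainInequalities_of_mul_le hn hT ((le_max_right _ _).trans hF)
    have hN := hN _ ((le_max_left _ _).trans hF)
    rw [(NonCoherent.capacity_eq_rateSum hn hT hsat).2,
      NonCoherent.rateSum_eq_sum_rankGain F (by omega) (by omega)]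
    have h1 := NonCoherent.abs_sum_rankGain_sub_le (n := n) (T := T) hq2
      (show 1 ≤ min m n by omega) (min_le_right m n) (by omega)
    set q : ℝ := (Fintype.card F : ℝ)
    have hl : Real.log q ≠ 0 := (Real.log_pos (by linarith)).ne'
    have hL : 0 ≤ Real.logb 2 q := Real.logb_nonneg one_lt_two (by linarith)
    have hδ : (if n ≤ min m n then 1 else 0 : ℝ) = if n ≤ m then 1 else 0 :=
      if_congr (by omega) rfl rfl
    rw [hδ] at h1
    have h2 := mul_le_mul_of_nonneg_left h1 hL
    rw [← abs_of_nonneg hL, ← abs_mul, abs_of_nonneg hL] at h2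
    refine le_trans (le_of_eq ?_) (h2.trans ?_)
    · congr 1
      simp only [Real.logb, Real.log_exp]
      field_simp
    · have h3 := mul_le_mul_of_nonneg_right hN (show 0 ≤ 1 / q by positivity)
      rw [← one_div]
      linarith
  · intro hmn
    filter_upwards [eventually_ge_atTop (2 * n + m)] with T hT F _ _ _
    rw [NonCoherent.satisfiesInequalities_iff_gain _ hn (by omega)]
    exact NonCoherent.gainInequalities_of_large
      (by exact_mod_cast (Fintype.one_lt_card : 1 < Fintype.card F)) hmn hT
  · intro hmn
    filter_upwards [eventually_gt_atTop (n + min m n)] with T hT F _ _ hF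
    rw [NonCoherent.satisfiesInequalities_iff_gain _ hn hT]
    exact NonCoherent.gainInequalities_of_mul_le hn hT hF
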